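/- **Proposition 5.1.3 (components of $\breve f^\sharp$).** *Setting.* Let $X=\mathbb R^{3+1}$. For $U\subset X$ open, consider the Grassmann algebra over $C^\infty(U)^{\mathbb C}$ (complex-valued smooth functions on $U$) on the eight anticommuting generators $\theta^\alpha,\bar\theta^{\dot\beta},\vartheta_\alpha,\bar\vartheta_{\dot\beta}$ ($\alpha\in\{1,2\}$, $\dot\beta\in\{\dot1,\dot2\}$). Let $\sigma^0=-\mathbf 1$, let $\sigma^1,\sigma^2,\sigma^3$ be the Pauli matrices, $\varepsilon^{12}=1=-\varepsilon^{21}$, $\varepsilon^{11}=\varepsilon^{22}=0$ (the same for dotted indices), $$\sigma^{\mu\alpha}{}_{\dot\beta}=\sum_\gamma\varepsilon^{\alpha\gamma}\sigma^\mu_{\gamma\dot\beta},\qquad \sigma^{\mu\dot\beta}_\alpha=\sum_{\dot\delta}\varepsilon^{\dot\beta\dot\delta}\sigma^\mu_{\alpha\dot\delta},\qquad \bar\sigma^{\mu\dot\beta\alpha}=\sum_{\gamma,\dot\delta}\varepsilon^{\alpha\gamma}\varepsilon^{\dot\beta\dot\delta}\sigma^\mu_{\gamma\dot\delta},$$ and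 $(\eta^{\mu\nu})=\mathrm{diag}(-1,1,1,1)$. The small function ring $C^\infty(\widehat U^{\widehat\boxplus})^{small}$ is the subring of the elements $$\begin{aligned}\breve g=\;&g_{(0)}+\sum_\alpha\theta^\alpha\vartheta_\alpha g_{(\alpha)}+\sum_{\dot\beta}\bar\theta^{\dot\beta}\bar\vartheta_{\dot\beta}g_{(\dot\beta)}+\theta^1\theta^2\vartheta_1\vartheta_2g_{(12)}\\ &+\sum_{\alpha,\dot\beta}\theta^\alpha\bar\theta^{\dot\beta}\Big(\sum_\mu\sigma^\mu_{\alpha\dot\beta}g_{[\mu]}+\vartheta_\alpha\bar\vartheta_{\dot\beta}g_{(\alpha\dot\beta)}\Big)+\bar\theta^{\dot1}\bar\theta^{\dot2}\bar\vartheta_{\dot1}\bar\vartheta_{\dot2}g_{(\dot1\dot2)}\\ &+\sum_{\dot\beta}\theta^1\theta^2\bar\theta^{\dot\beta}\Big(\sum_{\alpha,\mu}\vartheta_\alpha\sigma^{\mu\alpha}{}_{\dot\beta}g'_{[\mu]}+\vartheta_1\vartheta_2\bar\vartheta_{\dot\beta}g_{(12\dot\beta)}\Big) +\sum_\alpha\theta^\alpha\bar\theta^{\dot1}\bar\theta^{\dot2}\Big(\sum_{\dot\beta,\mu}\bar\vartheta_{\dot\beta}\sigma^{\mu\dot\beta}_\alpha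 g''_{[\mu]}+\vartheta_\alpha\bar\vartheta_{\dot1}\bar\vartheta_{\dot2}g_{(\alpha\dot1\dot2)}\Big)\\ &+\theta^1\theta^2\bar\theta^{\dot1}\bar\theta^{\dot2}\Big(g^\sim_{(0)}+\sum_{\alpha,\dot\beta,\mu}\vartheta_\alpha\bar\vartheta_{\dot\beta}\bar\sigma^{\mu\dot\beta\alpha}g^\sim_{[\mu]}+\vartheta_1\vartheta_2\bar\vartheta_{\dot1}\bar\vartheta_{\dot2}g_{(12\dot1\dot2)}\Big)\end{aligned}$$ with coefficients in $C^\infty(U)^{\mathbb C}$; the $33$ coefficients are uniquely determined and are called the components of $\breve g$. Let $Y$ be a smooth manifold (Hausdorff, second countable) of dimension $n$. A smooth map $\breve f=(f,\breve f^\sharp)$ from the small towered superspace to $Y$ is a smooth map $f:X\to Y$ together with an $\mathbb R$-algebra homomorphism $\breve f^\sharp:C^\infty(Y)\to C^\infty(\widehat X^{\widehat\boxplus})^{small}$ whose degree-zero component $f^\sharp_{(0)}$ is $f^\sharp: h\mapsto h\circ f$. Write $f^\sharp_{(\alpha)},f^\sharp_{[\mu]},\dots$ for the maps $C^\infty(Y)\to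 C^\infty(X)^{\mathbb C}$ that send $h$ to the components of $\breve f^\sharp(h)$. Say that $D:C^\infty(Y)\to C^\infty(X)^{\mathbb C}$ is a *$C^\infty(X)^{\mathbb C}$-valued differential operator along $f$ of order at most $r$ without zeroth-order term* (a smooth section of $\mathcal O_X^{\mathbb C}\otimes f^*\mathcal D_Y^{[1,r]}$) if for every chart $V$ of $Y$ with coordinates $y^1,\dots,y^n$ and every open $U\subset X$ with $f(U)\subset V$ there are $c_{i_1\cdots i_m}\in C^\infty(U)^{\mathbb C}$ with $D(h)|_U=\sum_{m=1}^r\sum_{i_1,\dots,i_m}c_{i_1\cdots i_m}\,f^\sharp(\partial_{i_1}\cdots\partial_{i_m}h)$ for all $h\in C^\infty(Y)$. *Claim.* Let $\breve f$ be such a smooth map. Then: 1. $f^\sharp_{(0)}=f^\sharp$. Moreover, for all open $V\subset Y$ and $U\subset X$ with $f(U)\subset V$ there is exactly one $\mathbb R$-algebra homomorphism $C^\infty(V)\to C^\infty(\widehat U^{\widehat\boxplus})^{small}$, again written $\breve f^\sharp$, that is compatible with $\breve f^\sharp$ under restriction (of functions from $Y$ to $V$, and of components from $X$ to $U$), and its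 degree-zero component is $h\mapsto h\circ f|_U$. 2. The other components of $\breve f^\sharp$, i.e. those of $\breve f^\sharp-f^\sharp_{(0)}$, are $C^\infty(X)^{\mathbb C}$-valued differential operators along $f$ without zeroth-order term, of order at most * $1$ for $f^\sharp_{(\alpha)},f^\sharp_{(\dot\beta)},f^\sharp_{[\mu]}$; * $2$ for $f^\sharp_{(12)},f^\sharp_{(\alpha\dot\beta)},f^\sharp_{(\dot1\dot2)},f^{\sharp\prime}_{[\mu]},f^{\sharp\prime\prime}_{[\mu]},f^{\sharp\sim}_{(0)}$; * $3$ for $f^\sharp_{(12\dot\beta)},f^\sharp_{(\alpha\dot1\dot2)},f^{\sharp\sim}_{[\mu]}$; * $4$ for $f^\sharp_{(12\dot1\dot2)}$. 3. Let $V$ be (the domain of) a chart of $Y$ with coordinates $y^1,\dots,y^n$, let $U\subset X$ be open with $f(U)\subset V$, and let $\breve n^i=\breve f^\sharp(y^i)-f^\sharp(y^i)\in C^\infty(\widehat U^{\widehat\boxplus})^{small}$; so $\breve n^i$ has degree-zero component $0$ and the other components of $\breve f^\sharp(y^i)$. For all $h\in C^\infty(V)$, $$\breve f^\sharp(h)=f^\sharp(h)+\sum_if^\sharp(\partial_ih)\,\breve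 n^i+\tfrac1{2}\sum_{i,j}f^\sharp(\partial_i\partial_jh)\,\breve n^i\breve n^j+\tfrac1{3!}\sum_{i,j,k}f^\sharp(\partial_i\partial_j\partial_kh)\,\breve n^i\breve n^j\breve n^k+\tfrac1{4!}\sum_{i,j,k,l}f^\sharp(\partial_i\partial_j\partial_k\partial_lh)\,\breve n^i\breve n^j\breve n^k\breve n^l .$$ In components, for every component index $s$ other than $(0)$, $$f^\sharp_s(h)=\sum_if^\sharp_s(y^i)\,f^\sharp(\partial_ih)+\tfrac12\sum_{i,j}J^{ij}_s\,f^\sharp(\partial_i\partial_jh)+\tfrac1{3!}\sum_{i,j,k}J^{ijk}_s\,f^\sharp(\partial_i\partial_j\partial_kh)+\tfrac1{4!}\sum_{i,j,k,l}J^{ijkl}_s\,f^\sharp(\partial_i\partial_j\partial_k\partial_lh),$$ where $J^{ij}_s,J^{ijk}_s,J^{ijkl}_s\in C^\infty(U)^{\mathbb C}$ are the components with index $s$ of $\breve n^i\breve n^j$, $\breve n^i\breve n^j\breve n^k$, $\breve n^i\breve n^j\breve n^k\breve n^l$. Here $J^{ij}_s=0$, $J^{ijk}_s=0$, $J^{ijkl}_s=0$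 if $s$ is $(0)$ or the order listed for $s$ in 2 is less than $2$, $3$, $4$ respectively. The $J$'s can be read off from the following expansions, in which $A_s,B_s,C_s,D_s$ stand for $f^\sharp_s(y^i),f^\sharp_s(y^j),f^\sharp_s(y^k),f^\sharp_s(y^l)$ and primes and tildes are attached to them as to $f^\sharp$: $$\begin{aligned}\breve n^i\breve n^j=&-\theta^1\theta^2\vartheta_1\vartheta_2\,(A_{(1)}B_{(2)}+A_{(2)}B_{(1)})-\sum_{\alpha,\dot\beta}\theta^\alpha\bar\theta^{\dot\beta}\vartheta_\alpha\bar\vartheta_{\dot\beta}\,(A_{(\alpha)}B_{(\dot\beta)}+A_{(\dot\beta)}B_{(\alpha)})-\bar\theta^{\dot1}\bar\theta^{\dot2}\bar\vartheta_{\dot1}\bar\vartheta_{\dot2}\,(A_{(\dot1)}B_{(\dot2)}+A_{(\dot2)}B_{(\dot1)})\\ &+\sum_{\dot\beta}\theta^1\theta^2\bar\theta^{\dot\beta}\Big\{\sum_{\alpha,\mu}\vartheta_\alpha\sigma^{\mu\alpha}{}_{\dot\beta}\,(A_{(\alpha)}B_{[\mu]}+A_{[\mu]}B_{(\alpha)})\\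 &\qquad+\vartheta_1\vartheta_2\bar\vartheta_{\dot\beta}\,(A_{(12)}B_{(\dot\beta)}+A_{(1\dot\beta)}B_{(2)}+A_{(2\dot\beta)}B_{(1)}+A_{(1)}B_{(2\dot\beta)}+A_{(2)}B_{(1\dot\beta)}+A_{(\dot\beta)}B_{(12)})\Big\}\\ &+\sum_\alpha\theta^\alpha\bar\theta^{\dot1}\bar\theta^{\dot2}\Big\{-\sum_{\dot\beta,\mu}\bar\vartheta_{\dot\beta}\sigma^{\mu\dot\beta}_\alpha\,(A_{(\dot\beta)}B_{[\mu]}+A_{[\mu]}B_{(\dot\beta)})\\ &\qquad+\vartheta_\alpha\bar\vartheta_{\dot1}\bar\vartheta_{\dot2}\,(A_{(\dot1\dot2)}B_{(\alpha)}+A_{(\alpha\dot1)}B_{(\dot2)}+A_{(\alpha\dot2)}B_{(\dot1)}+A_{(\dot1)}B_{(\alpha\dot2)}+A_{(\dot2)}B_{(\alpha\dot1)}+A_{(\alpha)}B_{(\dot1\dot2)})\Big\}\\ &+\theta^1\theta^2\bar\theta^{\dot1}\bar\theta^{\dot2}\Big\{2\sum_{\mu,\nu}\eta^{\mu\nu}A_{[\mu]}B_{[\nu]}\\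 &\qquad+\sum_{\alpha,\dot\beta,\mu}\vartheta_\alpha\bar\vartheta_{\dot\beta}\bar\sigma^{\mu\dot\beta\alpha}\,(-A_{(\alpha)}B''_{[\mu]}+A_{(\dot\beta)}B'_{[\mu]}-A_{(\alpha\dot\beta)}B_{[\mu]}-A''_{[\mu]}B_{(\alpha)}+A'_{[\mu]}B_{(\dot\beta)}-A_{[\mu]}B_{(\alpha\dot\beta)})\\ &\qquad+\vartheta_1\vartheta_2\bar\vartheta_{\dot1}\bar\vartheta_{\dot2}\,(-A_{(12\dot1)}B_{(\dot2)}-A_{(12\dot2)}B_{(\dot1)}-A_{(1\dot1\dot2)}B_{(2)}-A_{(2\dot1\dot2)}B_{(1)}+A_{(12)}B_{(\dot1\dot2)}+A_{(1\dot1)}B_{(2\dot2)}+A_{(1\dot2)}B_{(2\dot1)}\\ &\qquad\quad+A_{(2\dot1)}B_{(1\dot2)}+A_{(2\dot2)}B_{(1\dot1)}+A_{(\dot1\dot2)}B_{(12)}-A_{(1)}B_{(2\dot1\dot2)}-A_{(2)}B_{(1\dot1\dot2)}-A_{(\dot1)}B_{(12\dot2)}-A_{(\dot2)}B_{(12\dot1)})\Big\}.\end{aligned}$$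 With $\{s,t\}_{AB}=A_sB_t+A_tB_s$ and $S(r;s,t)=A_r\{s,t\}_{BC}+B_r\{s,t\}_{AC}+C_r\{s,t\}_{AB}$, $$\begin{aligned}\breve n^i\breve n^j\breve n^k=&-\sum_{\dot\beta}\theta^1\theta^2\bar\theta^{\dot\beta}\vartheta_1\vartheta_2\bar\vartheta_{\dot\beta}\,S((\dot\beta);(1),(2))-\sum_\alpha\theta^\alpha\bar\theta^{\dot1}\bar\theta^{\dot2}\vartheta_\alpha\bar\vartheta_{\dot1}\bar\vartheta_{\dot2}\,S((\alpha);(\dot1),(\dot2))\\ &+\theta^1\theta^2\bar\theta^{\dot1}\bar\theta^{\dot2}\Big\{\sum_{\alpha,\dot\beta,\mu}\vartheta_\alpha\bar\vartheta_{\dot\beta}\bar\sigma^{\mu\dot\beta\alpha}\,S([\mu];(\alpha),(\dot\beta))-\vartheta_1\vartheta_2\bar\vartheta_{\dot1}\bar\vartheta_{\dot2}\,\big(S((12);(\dot1),(\dot2))+S((1\dot1);(2),(\dot2))\\ &\qquad+S((1\dot2);(2),(\dot1))+S((2\dot1);(1),(\dot2))+S((2\dot2);(1),(\dot1))+S((\dot1\dot2);(1),(2))\big)\Big\},\\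 \breve n^i\breve n^j\breve n^k\breve n^l=&\;\theta^1\theta^2\bar\theta^{\dot1}\bar\theta^{\dot2}\vartheta_1\vartheta_2\bar\vartheta_{\dot1}\bar\vartheta_{\dot2}\,\Big(\{(1),(2)\}_{AB}\{(\dot1),(\dot2)\}_{CD}+\{(\dot1),(\dot2)\}_{AB}\{(1),(2)\}_{CD}\\ &\qquad+\sum_{\alpha\ne\gamma,\ \dot\beta\ne\dot\delta}\{(\alpha),(\dot\beta)\}_{AB}\{(\gamma),(\dot\delta)\}_{CD}\Big).\end{aligned}$$ -/

import Mathlib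

open scoped Manifold ContDiff

namespace TowSup

/-! ### Grassmann algebra, Pauli matrices, small superfields -/

/-- Index set of the components of a small superfield. In the order of the constructors:
`f_(0)`, `f_(α)`, `f_(β̇)`, `f_(12)`, `f_[μ]`, `f_(αβ̇)`, `f_(1̇2̇)`, `f'_[μ]`, `f_(12β̇)`,
`f''_[μ]`, `f_(α1̇2̇)`, `f~_(0)`, `f~_[μ]`, `f_(121̇2̇)`. -/
inductive SmallIndex : Type
  | zero
  | a (α : Fin 2)
  | b (β : Fin 2)
  | aa
  | vec (μ : Fin 4)
  | ab (α β : Fin 2)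
  | bb
  | vecP (μ : Fin 4)
  | aab (β : Fin 2)
  | vecPP (μ : Fin 4)
  | abb (α : Fin 2)
  | zeroT
  | vecT (μ : Fin 4)
  | aabb
  deriving DecidableEq, Fintype

/-- The order of the differential operator attached to a component. -/
def SmallIndex.order : SmallIndex → ℕ
  | .zero => 0
  | .a _ => 1
  | .b _ => 1
  | .aa => 2
  | .vec _ => 1
  | .ab _ _ => 2
  | .bb => 2
  | .vecP _ => 2
  | .aab _ => 3
  | .vecPP _ => 2
  | .abb _ => 3
  | .zeroT => 2
  | .vecT _ => 3
  | .aabb => 4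

/-- The matrices `σ^μ_{αβ̇}`, with `σ^0 = -1`. -/
noncomputable def pauli : Fin 4 → Matrix (Fin 2) (Fin 2) ℂ :=
  ![!![-1, 0; 0, -1], !![0, 1; 1, 0], !![0, -Complex.I; Complex.I, 0], !![1, 0; 0, -1]]

/-- The symplectic tensor with upper indices, `ε^{12} = 1`. -/
def epsUp : Matrix (Fin 2) (Fin 2) ℂ := !![0, 1; -1, 0]

/-- `σ^{μα}_β̇ = ∑_γ ε^{αγ} σ^μ_{γβ̇}`. -/
noncomputable def pauliL (μ : Fin 4) (α β : Fin 2) : ℂ := ∑ γ, epsUp α γ * pauli μ γ β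

/-- `σ^{μβ̇}_α = ∑_δ̇ ε^{β̇δ̇} σ^μ_{αδ̇}`. -/
noncomputable def pauliR (μ : Fin 4) (α β : Fin 2) : ℂ := ∑ δ, epsUp β δ * pauli μ α δ

/-- `σ̄^{μβ̇α} = ∑_{γδ̇} ε^{αγ} ε^{β̇δ̇} σ^μ_{γδ̇}`. -/
noncomputable def pauliBar (μ : Fin 4) (β α : Fin 2) : ℂ :=
  ∑ γ, ∑ δ, epsUp α γ * epsUp β δ * pauli μ γ δ

/-- The (inverse) Minkowski metric of signature `(-+++)`. -/
def minkowski : Matrix (Fin 4) (Fin 4) ℂ := Matrix.diagonal ![-1, 1, 1, 1]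

section Grassmann

variable (R : Type*) [CommRing R]

/-- The Grassmann algebra `R[θ, θ̄, ϑ, ϑ̄]` over `R` on the eight anticommuting generators
`θ^1, θ^2, θ̄^1̇, θ̄^2̇, ϑ_1, ϑ_2, ϑ̄_1̇, ϑ̄_2̇` (in this order). -/
abbrev Grassmann : Type _ := ExteriorAlgebra R (Fin 8 → R)

/-- The eight anticommuting generators. -/
noncomputable def oddGen (i : Fin 8) : Grassmann R := ExteriorAlgebra.ι R (Pi.single i 1)

/-- `θ^α` -/
noncomputable def th (α : Fin 2) : Grassmann R := oddGen R (![0, 1] α)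
/-- `θ̄^β̇` -/
noncomputable def thb (β : Fin 2) : Grassmann R := oddGen R (![2, 3] β)
/-- `ϑ_α` -/
noncomputable def vt (α : Fin 2) : Grassmann R := oddGen R (![4, 5] α)
/-- `ϑ̄_β̇` -/
noncomputable def vtb (β : Fin 2) : Grassmann R := oddGen R (![6, 7] β)

variable [Algebra ℂ R]

/-- The element of the Grassmann algebra that a component of a small superfield multiplies: a small
superfield is an element `∑ k, f k • smallGen k`. -/
noncomputable def smallGen : SmallIndex → Grassmann R
  | .zero => 1
  | .a α => th R α * vt R α
  | .b β => thb R β * vtb R β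
  | .aa => th R 0 * th R 1 * vt R 0 * vt R 1
  | .vec μ => ∑ α, ∑ β, pauli μ α β • (th R α * thb R β)
  | .ab α β => th R α * thb R β * vt R α * vtb R β
  | .bb => thb R 0 * thb R 1 * vtb R 0 * vtb R 1
  | .vecP μ => ∑ β, ∑ α, pauliL μ α β • (th R 0 * th R 1 * thb R β * vt R α)
  | .aab β => th R 0 * th R 1 * thb R β * vt R 0 * vt R 1 * vtb R β
  | .vecPP μ => ∑ α, ∑ β, pauliR μ α β • (th R α * thb R 0 * thb R 1 * vtb R β)
  | .abb α => th R α * thb R 0 * thb R 1 * vt R α * vtb R 0 * vtb R 1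
  | .zeroT => th R 0 * th R 1 * thb R 0 * thb R 1
  | .vecT μ => ∑ α, ∑ β,
      pauliBar μ β α • (th R 0 * th R 1 * thb R 0 * thb R 1 * vt R α * vtb R β)
  | .aabb => th R 0 * th R 1 * thb R 0 * thb R 1 * vt R 0 * vt R 1 * vtb R 0 * vtb R 1

end Grassmann

/-! ### Helper facts: small superfields form a subring, free on the elements `smallGen` -/

section Helpers

/-- The coefficients of the four vectorial families, the pair `(α, β̇)` being numbered
`0, 1, 2, 3` (bookkeeping). -/
noncomputable def vecCoef (μ i : Fin 4) : ℂ := pauli μ (![0, 0, 1, 1] i) (![0, 1, 0, 1] i)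
/-- As `vecCoef`. -/
noncomputable def vecCoefL (μ i : Fin 4) : ℂ := pauliL μ (![0, 0, 1, 1] i) (![0, 1, 0, 1] i)
/-- As `vecCoef`. -/
noncomputable def vecCoefR (μ i : Fin 4) : ℂ := pauliR μ (![0, 0, 1, 1] i) (![0, 1, 0, 1] i)
/-- As `vecCoef`. -/
noncomputable def vecCoefB (μ i : Fin 4) : ℂ := pauliBar μ (![0, 1, 0, 1] i) (![0, 0, 1, 1] i)

/-- The ordered list of the generators in a monomial. The index `vec i` is used here for the
monomial `θ^α θ̄^β̇` with `(α, β̇)` the `i`-th pair, and similarly for the other three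
vectorial families. -/
def monList : SmallIndex → List (Fin 8)
  | .zero => []
  | .a α => [![0, 1] α, ![4, 5] α]
  | .b β => [![2, 3] β, ![6, 7] β]
  | .aa => [0, 1, 4, 5]
  | .vec μ => [![0, 0, 1, 1] μ, ![2, 3, 2, 3] μ]
  | .ab α β => [![0, 1] α, ![2, 3] β, ![4, 5] α, ![6, 7] β]
  | .bb => [2, 3, 6, 7]
  | .vecP μ => [0, 1, ![2, 3, 2, 3] μ, ![4, 4, 5, 5] μ]
  | .aab β => [0, 1, ![2, 3] β, 4, 5, ![6, 7] β]
  | .vecPP μ => [![0, 0, 1, 1] μ, 2, 3, ![6, 7, 6, 7] μ]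
  | .abb α => [![0, 1] α, 2, 3, ![4, 5] α, 6, 7]
  | .zeroT => [0, 1, 2, 3]
  | .vecT μ => [0, 1, 2, 3, ![4, 4, 5, 5] μ, ![6, 7, 6, 7] μ]
  | .aabb => [0, 1, 2, 3, 4, 5, 6, 7]

/-- The set of generators in a monomial. -/
def monSupp (k : SmallIndex) : Finset (Fin 8) := (monList k).toFinset

theorem monList_sorted (k : SmallIndex) : (monList k).Pairwise (· < ·) := by
  revert k; decide

theorem monList_injective : Function.Injective monList := by
  intro k l; revert k l; decide

theorem monSupp_injective : Function.Injective monSupp := by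
  intro k l h
  apply monList_injective
  refine List.Perm.eq_of_pairwise (le := (· < ·)) (fun a b _ _ h1 h2 => absurd h1 h2.not_gt)
    (monList_sorted k) (monList_sorted l) ?_
  exact (List.perm_ext_iff_of_nodup ((monList_sorted k).imp ne_of_lt)
    ((monList_sorted l).imp ne_of_lt)).2 fun x => by
      simpa [monSupp] using Finset.ext_iff.1 h x

/-- The set of generators in a list, as a bit mask. -/
def bitMask (l : List (Fin 8)) : ℕ := l.foldr (fun i m => 2 ^ i.val ||| m) 0

theorem testBit_bitMask (l : List (Fin 8)) (i : Fin 8) :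
    (bitMask l).testBit i = true ↔ i ∈ l := by
  induction l with
  | nil => simp [bitMask]
  | cons a l ih =>
    have h : bitMask (a :: l) = 2 ^ a.val ||| bitMask l := rfl
    rw [h, Nat.testBit_or, Bool.or_eq_true, ih, Nat.testBit_two_pow, decide_eq_true_iff,
      List.mem_cons, Fin.val_inj, eq_comm]

theorem bitMask_union (k l : SmallIndex) :
    bitMask (monList k) &&& bitMask (monList l) ≠ 0 ∨
      ∃ m, bitMask (monList m) = bitMask (monList k) ||| bitMask (monList l) := by
  revert k l; decide +kernel

theorem monSupp_union (k l : SmallIndex) (h : Disjoint (monSupp k) (monSupp l)) :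
    ∃ m, monSupp m = monSupp k ∪ monSupp l := by
  rcases bitMask_union k l with h0 | ⟨m, hm⟩
  · obtain ⟨i, hi⟩ := Nat.exists_testBit_of_ne_zero h0
    rw [Nat.testBit_and, Bool.and_eq_true] at hi
    have hlt : ∀ (l : List (Fin 8)) (i : ℕ), (bitMask l).testBit i = true → i < 8 := by
      intro l i hi
      induction l with
      | nil => simp [bitMask] at hi
      | cons a l ih =>
        have h : bitMask (a :: l) = 2 ^ a.val ||| bitMask l := rfl
        rw [h, Nat.testBit_or, Bool.or_eq_true, Nat.testBit_two_pow, decide_eq_true_iff] at hi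
        rcases hi with hi | hi
        · omega
        · exact ih hi
    have h8 := hlt _ _ hi.1
    have h1 := (testBit_bitMask (monList k) ⟨i, h8⟩).1 hi.1
    have h2 := (testBit_bitMask (monList l) ⟨i, h8⟩).1 hi.2
    exact absurd (List.mem_toFinset.2 h2) (Finset.disjoint_left.1 h (List.mem_toFinset.2 h1))
  · refine ⟨m, Finset.ext fun i => ?_⟩
    rw [Finset.mem_union, monSupp, monSupp, monSupp, List.mem_toFinset, List.mem_toFinset,
      List.mem_toFinset, ← testBit_bitMask, ← testBit_bitMask, ← testBit_bitMask, hm,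
      Nat.testBit_or, Bool.or_eq_true]

variable (R : Type*) [CommRing R]

/-- The monomial basis of the Grassmann algebra. -/
noncomputable def monBasis : Module.Basis (Finset (Fin 8)) R (Grassmann R) :=
  (Pi.basisFun R (Fin 8)).ExteriorAlgebra

/-- The monomials of a small superfield. -/
noncomputable def mon (k : SmallIndex) : Grassmann R := monBasis R (monSupp k)

open Set.powersetCard in
theorem mon_eq (k : SmallIndex) : ((monList k).map (oddGen R)).prod = mon R k := by
  unfold mon monBasis monSupp
  have hl := monList_sorted k
  generalize monList k = l at hl
  have hc : l.toFinset.card = l.length := List.toFinset_card_of_nodup (hl.imp ne_of_lt)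
  rw [ExteriorAlgebra.basis_apply_ofCard _ hc, ExteriorAlgebra.ιMulti_family,
    ExteriorAlgebra.ιMulti_apply]
  have hm : StrictMono l.get := fun i j hij => List.pairwise_iff_get.mp hl i j hij
  have he : ofFinEmbEquiv.symm (ofCard hc) = OrderEmbedding.ofStrictMono l.get hm := by
    rw [Equiv.symm_apply_eq]
    apply Subtype.ext
    ext x
    have := mem_ofFinEmbEquiv_iff_mem_range (OrderEmbedding.ofStrictMono l.get hm) x
    refine Iff.trans ?_ this.symm
    simp [ofCard, List.mem_iff_get]
  rw [he]
  congr 1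
  apply List.ext_get
  · simp
  · intro n h1 h2
    simp [oddGen]

theorem mon_mul (k l : SmallIndex) :
    mon R k * mon R l ∈ Submodule.span R (Set.range (mon R)) := by
  by_cases h : Disjoint (monSupp k) (monSupp l)
  · obtain ⟨m, hm⟩ := monSupp_union k l h
    have := ExteriorAlgebra.basis_mul_of_disjoint (Pi.basisFun R (Fin 8))
      (Set.powersetCard.ofCard (s := monSupp k) rfl)
      (Set.powersetCard.ofCard (s := monSupp l) rfl) h
    have hz : ∃ (z : ℤˣ) (t : Finset (Fin 8)), t = monSupp k ∪ monSupp l ∧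
        mon R k * mon R l = z • monBasis R t :=
      ⟨_, _, Set.powersetCard.coe_disjUnion.trans (Finset.disjUnion_eq_union _ _ _), this⟩
    obtain ⟨z, t, ht, hz⟩ := hz
    rw [hz, Units.smul_def]
    have hx : monBasis R t ∈ Submodule.span R (Set.range (mon R)) :=
      Submodule.subset_span ⟨m, by rw [mon, hm, ht]⟩
    exact zsmul_mem hx _
  · have := ExteriorAlgebra.basis_mul_of_not_disjoint (Pi.basisFun R (Fin 8))
      (Set.powersetCard.ofCard (s := monSupp k) rfl)
      (Set.powersetCard.ofCard (s := monSupp l) rfl) h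
    change mon R k * mon R l = 0 at this
    rw [this]
    exact zero_mem _

theorem mon_repr (k : SmallIndex) (l : SmallIndex) :
    (monBasis R).coord (monSupp l) (mon R k) = if l = k then 1 else 0 := by
  simp [mon, Finsupp.single_apply, monSupp_injective.eq_iff, eq_comm]

variable [Algebra ℂ R]

theorem smallGen_eq (k : SmallIndex) : smallGen R k = match k with
    | .vec μ => ∑ i, algebraMap ℂ R (vecCoef μ i) • mon R (.vec i)
    | .vecP μ => ∑ i, algebraMap ℂ R (vecCoefL μ i) • mon R (.vecP i)
    | .vecPP μ => ∑ i, algebraMap ℂ R (vecCoefR μ i) • mon R (.vecPP i)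
    | .vecT μ => ∑ i, algebraMap ℂ R (vecCoefB μ i) • mon R (.vecT i)
    | k => mon R k := by
  rcases k with _ | α | β | _ | μ | ⟨α, β⟩ | _ | μ | β | μ | α | _ | μ | _ <;>
    simp [smallGen, ← mon_eq, monList, th, thb, vt, vtb, mul_assoc, Fin.sum_univ_four,
      algebraMap_smul, vecCoef, vecCoefL, vecCoefR, vecCoefB]
  all_goals abel

/-- Orthonormality of a table of coefficients. -/
def IsOrtho (c : Fin 4 → Fin 4 → ℂ) : Prop :=
  (∀ μ ν, ∑ i, star (c μ i) / 2 * c ν i = if μ = ν then 1 else 0) ∧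
    ∀ i j, ∑ μ, star (c μ i) / 2 * c μ j = if i = j then 1 else 0

theorem isOrtho_vecCoef : IsOrtho vecCoef := by
  refine ⟨?_, ?_⟩ <;> intro i j <;> fin_cases i <;> fin_cases j <;>
    simp [vecCoef, pauli, Fin.sum_univ_four] <;> ring_nf <;> simp <;> norm_num

theorem isOrtho_vecCoefL : IsOrtho vecCoefL := by
  refine ⟨?_, ?_⟩ <;> intro i j <;> fin_cases i <;> fin_cases j <;>
    simp [vecCoefL, pauliL, epsUp, pauli, Fin.sum_univ_four] <;> ring_nf <;> simp <;> norm_num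

theorem isOrtho_vecCoefR : IsOrtho vecCoefR := by
  refine ⟨?_, ?_⟩ <;> intro i j <;> fin_cases i <;> fin_cases j <;>
    simp [vecCoefR, pauliR, epsUp, pauli, Fin.sum_univ_four] <;> ring_nf <;> simp <;> norm_num

theorem isOrtho_vecCoefB : IsOrtho vecCoefB := by
  refine ⟨?_, ?_⟩ <;> intro i j <;> fin_cases i <;> fin_cases j <;>
    simp [vecCoefB, pauliBar, epsUp, pauli, Fin.sum_univ_four] <;> ring_nf <;> simp <;> norm_num

/-- A functional dual to `smallGen R k`. -/
noncomputable def dualGen (k : SmallIndex) : Grassmann R →ₗ[R] R := match k with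
    | .vec μ => ∑ i, algebraMap ℂ R (star (vecCoef μ i) / 2) •
        (monBasis R).coord (monSupp (.vec i))
    | .vecP μ => ∑ i, algebraMap ℂ R (star (vecCoefL μ i) / 2) •
        (monBasis R).coord (monSupp (.vecP i))
    | .vecPP μ => ∑ i, algebraMap ℂ R (star (vecCoefR μ i) / 2) •
        (monBasis R).coord (monSupp (.vecPP i))
    | .vecT μ => ∑ i, algebraMap ℂ R (star (vecCoefB μ i) / 2) •
        (monBasis R).coord (monSupp (.vecT i))
    | k => (monBasis R).coord (monSupp k)

theorem dual_aux {c : Fin 4 → Fin 4 → ℂ} (hc : IsOrtho c) (V : Fin 4 → SmallIndex)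
    (hV : Function.Injective V) (μ ν : Fin 4) :
    (∑ i, algebraMap ℂ R (star (c μ i) / 2) • (monBasis R).coord (monSupp (V i)))
      (∑ i, algebraMap ℂ R (c ν i) • mon R (V i)) = if μ = ν then 1 else 0 := by
  have h := congrArg (algebraMap ℂ R) (hc.1 μ ν)
  simp only [map_sum, map_mul] at h
  simp only [map_sum, map_smul, LinearMap.sum_apply, LinearMap.smul_apply, mon_repr, hV.eq_iff,
    smul_eq_mul, mul_ite, mul_one, mul_zero, Finset.sum_ite_eq', Finset.mem_univ, if_true]
  refine (Finset.sum_congr rfl fun i _ => mul_comm _ _).trans (h.trans ?_)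
  split_ifs <;> simp

theorem dualGen_smallGen (k l : SmallIndex) :
    dualGen R k (smallGen R l) = if k = l then 1 else 0 := by
  have e1 := dual_aux R isOrtho_vecCoef .vec (fun _ _ h => by simpa using h)
  have e2 := dual_aux R isOrtho_vecCoefL .vecP (fun _ _ h => by simpa using h)
  have e3 := dual_aux R isOrtho_vecCoefR .vecPP (fun _ _ h => by simpa using h)
  have e4 := dual_aux R isOrtho_vecCoefB .vecT (fun _ _ h => by simpa using h)
  rw [smallGen_eq]
  rcases k with _ | α | β | _ | μ | ⟨α, β⟩ | _ | μ | β | μ | α | _ | μ | _ <;>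
  rcases l with _ | γ | δ | _ | ν | ⟨γ, δ⟩ | _ | ν | δ | ν | γ | _ | ν | _ <;>
    first
    | simp only [dualGen, e1, e2, e3, e4, SmallIndex.vec.injEq, SmallIndex.vecP.injEq,
        SmallIndex.vecPP.injEq, SmallIndex.vecT.injEq]; done
    | simp only [dualGen, map_sum, map_smul, LinearMap.sum_apply, LinearMap.smul_apply, mon_repr,
        reduceCtorEq, if_false, smul_zero, Finset.sum_const_zero]

theorem smallGen_linearIndependent : LinearIndependent R (smallGen R) := by
  rw [Fintype.linearIndependent_iff]
  intro c h k
  have := congrArg (dualGen R k) h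
  simpa [map_sum, dualGen_smallGen] using this

theorem span_aux {c : Fin 4 → Fin 4 → ℂ} (hc : IsOrtho c) (V : Fin 4 → SmallIndex)
    (G : Fin 4 → Grassmann R) (hG : ∀ μ, G μ = ∑ i, algebraMap ℂ R (c μ i) • mon R (V i))
    (j : Fin 4) : mon R (V j) = ∑ μ, algebraMap ℂ R (star (c μ j) / 2) • G μ := by
  simp only [hG, Finset.smul_sum, smul_smul, ← map_mul]
  rw [Finset.sum_comm]
  simp only [← Finset.sum_smul, ← map_sum, hc.2]
  simp

theorem span_smallGen : Submodule.span R (Set.range (smallGen R)) =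
    Submodule.span R (Set.range (mon R)) := by
  apply le_antisymm <;> rw [Submodule.span_le]
  · rintro _ ⟨k, rfl⟩
    rw [smallGen_eq]
    have hm : ∀ l, mon R l ∈ Submodule.span R (Set.range (mon R)) :=
      fun l => Submodule.subset_span ⟨l, rfl⟩
    rcases k with _ | α | β | _ | μ | ⟨α, β⟩ | _ | μ | β | μ | α | _ | μ | _ <;>
      first
      | exact hm _
      | exact Submodule.sum_mem _ fun i _ => Submodule.smul_mem _ _ (hm _)
  · rintro _ ⟨k, rfl⟩
    have hm : ∀ l, smallGen R l ∈ Submodule.span R (Set.range (smallGen R)) :=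
      fun l => Submodule.subset_span ⟨l, rfl⟩
    have key : ∀ {c : Fin 4 → Fin 4 → ℂ} (_ : IsOrtho c) (V : Fin 4 → SmallIndex)
        (_ : ∀ μ, smallGen R (V μ) = ∑ i, algebraMap ℂ R (c μ i) • mon R (V i)) (j : Fin 4),
        mon R (V j) ∈ Submodule.span R (Set.range (smallGen R)) := by
      intro c hc V hV j
      rw [span_aux R hc V (fun μ => smallGen R (V μ)) hV j]
      exact Submodule.sum_mem _ fun i _ => Submodule.smul_mem _ _ (hm _)
    have key0 : ∀ l, smallGen R l = mon R l → mon R l ∈ Submodule.span R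
        (Set.range (smallGen R)) := fun l h => h ▸ hm l
    rcases k with _ | α | β | _ | μ | ⟨α, β⟩ | _ | μ | β | μ | α | _ | μ | _
    · exact key0 _ (smallGen_eq R .zero)
    · exact key0 _ (smallGen_eq R (.a α))
    · exact key0 _ (smallGen_eq R (.b β))
    · exact key0 _ (smallGen_eq R .aa)
    · exact key isOrtho_vecCoef .vec (fun ν => smallGen_eq R (.vec ν)) μ
    · exact key0 _ (smallGen_eq R (.ab α β))
    · exact key0 _ (smallGen_eq R .bb)
    · exact key isOrtho_vecCoefL .vecP (fun ν => smallGen_eq R (.vecP ν)) μ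
    · exact key0 _ (smallGen_eq R (.aab β))
    · exact key isOrtho_vecCoefR .vecPP (fun ν => smallGen_eq R (.vecPP ν)) μ
    · exact key0 _ (smallGen_eq R (.abb α))
    · exact key0 _ (smallGen_eq R .zeroT)
    · exact key isOrtho_vecCoefB .vecT (fun ν => smallGen_eq R (.vecT ν)) μ
    · exact key0 _ (smallGen_eq R .aabb)

theorem one_mem_span : (1 : Grassmann R) ∈ Submodule.span R (Set.range (smallGen R)) :=
  Submodule.subset_span ⟨.zero, rfl⟩

theorem mul_mem_span (x y : Grassmann R) (hx : x ∈ Submodule.span R (Set.range (smallGen R)))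
    (hy : y ∈ Submodule.span R (Set.range (smallGen R))) :
    x * y ∈ Submodule.span R (Set.range (smallGen R)) := by
  rw [span_smallGen] at *
  have h := Submodule.mul_mem_mul hx hy
  rw [Submodule.span_mul_span] at h
  refine Submodule.span_le.2 ?_ h
  rintro _ ⟨_, ⟨k, rfl⟩, _, ⟨l, rfl⟩, rfl⟩
  exact mon_mul R k l

end Helpers

section SmallRing

variable (R : Type*) [CommRing R] [Algebra ℂ R]

/-- The small function ring over `R`: the subring of the Grassmann algebra `R[θ, θ̄, ϑ, ϑ̄]`
formed by the elements `∑ k, f k • smallGen R k` with `f k ∈ R`. -/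
noncomputable def smallRing : Subalgebra R (Grassmann R) :=
  (Submodule.span R (Set.range (smallGen R))).toSubalgebra (one_mem_span R) (mul_mem_span R)

/-- `smallGen R k` as an element of the small function ring. -/
noncomputable def smallElt (k : SmallIndex) : smallRing R :=
  ⟨smallGen R k, Submodule.subset_span ⟨k, rfl⟩⟩

/-- The elements `smallGen R k` form a basis of the small function ring. -/
noncomputable def smallBasis : Module.Basis SmallIndex R (smallRing R) :=
  Module.Basis.mk (v := smallElt R)
    (LinearIndependent.of_comp (smallRing R).val.toLinearMap (smallGen_linearIndependent R))
    (by
      rintro ⟨x, hx⟩ -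
      have hx' : x ∈ Submodule.span R (Set.range (smallGen R)) := hx
      have hr : Set.range (smallGen R) =
          (smallRing R).val.toLinearMap '' Set.range (smallElt R) := by
        rw [← Set.range_comp]; rfl
      rw [hr, ← Submodule.map_span] at hx'
      obtain ⟨z, hz, hzx⟩ := hx'
      have : z = ⟨x, hx⟩ := Subtype.ext hzx
      exact this ▸ hz)

variable {R}

/-- The component of a small superfield with index `k`. -/
noncomputable def component (k : SmallIndex) : smallRing R →ₗ[R] R := (smallBasis R).coord k

/-- The right-hand side of the expansion of the product of two elements without degree-zero
component, in terms of the components `A`, `B` of the factors. -/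
noncomputable def expansion₂ (A B : SmallIndex → R) : Grassmann R :=
  -((A (.a 0) * B (.a 1) + A (.a 1) * B (.a 0)) • (th R 0 * th R 1 * vt R 0 * vt R 1))
  - ∑ α, ∑ β, (A (.a α) * B (.b β) + A (.b β) * B (.a α)) •
      (th R α * thb R β * vt R α * vtb R β)
  - (A (.b 0) * B (.b 1) + A (.b 1) * B (.b 0)) • (thb R 0 * thb R 1 * vtb R 0 * vtb R 1)
  + ∑ β, (∑ α, ∑ μ, (pauliL μ α β • (A (.a α) * B (.vec μ) + A (.vec μ) * B (.a α))) •
        (th R 0 * th R 1 * thb R β * vt R α)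
      + (A .aa * B (.b β) + A (.ab 0 β) * B (.a 1) + A (.ab 1 β) * B (.a 0)
          + A (.a 0) * B (.ab 1 β) + A (.a 1) * B (.ab 0 β) + A (.b β) * B .aa) •
        (th R 0 * th R 1 * thb R β * vt R 0 * vt R 1 * vtb R β))
  + ∑ α, (-(∑ β, ∑ μ, (pauliR μ α β • (A (.b β) * B (.vec μ) + A (.vec μ) * B (.b β))) •
        (th R α * thb R 0 * thb R 1 * vtb R β))
      + (A .bb * B (.a α) + A (.ab α 0) * B (.b 1) + A (.ab α 1) * B (.b 0)
          + A (.b 0) * B (.ab α 1) + A (.b 1) * B (.ab α 0) + A (.a α) * B .bb) •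
        (th R α * thb R 0 * thb R 1 * vt R α * vtb R 0 * vtb R 1))
  + (2 * ∑ μ, ∑ ν, minkowski μ ν • (A (.vec μ) * B (.vec ν))) •
      (th R 0 * th R 1 * thb R 0 * thb R 1)
  + ∑ α, ∑ β, ∑ μ, (pauliBar μ β α •
        (-(A (.a α) * B (.vecPP μ)) + A (.b β) * B (.vecP μ) - A (.ab α β) * B (.vec μ)
          - A (.vecPP μ) * B (.a α) + A (.vecP μ) * B (.b β) - A (.vec μ) * B (.ab α β))) •
      (th R 0 * th R 1 * thb R 0 * thb R 1 * vt R α * vtb R β)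
  + (-(A (.aab 0) * B (.b 1)) - A (.aab 1) * B (.b 0)
      - A (.abb 0) * B (.a 1) - A (.abb 1) * B (.a 0)
      + A .aa * B .bb + A (.ab 0 0) * B (.ab 1 1) + A (.ab 0 1) * B (.ab 1 0)
      + A (.ab 1 0) * B (.ab 0 1) + A (.ab 1 1) * B (.ab 0 0) + A .bb * B .aa
      - A (.a 0) * B (.abb 1) - A (.a 1) * B (.abb 0)
      - A (.b 0) * B (.aab 1) - A (.b 1) * B (.aab 0)) •
      (th R 0 * th R 1 * thb R 0 * thb R 1 * vt R 0 * vt R 1 * vtb R 0 * vtb R 1)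

/-- The symmetrised product `A k * B l + A l * B k` of components. -/
def symm₂ (k l : SmallIndex) (A B : SmallIndex → R) : R := A k * B l + A l * B k

/-- The sum of the terms `A m * (B k * C l + B l * C k)` over the three cyclic choices of the
factor whose component `m` is taken. -/
def symm₃ (m k l : SmallIndex) (A B C : SmallIndex → R) : R :=
  A m * symm₂ k l B C + B m * symm₂ k l A C + C m * symm₂ k l A B

/-- The right-hand side of the expansion of the product of three elements without degree-zero
component. -/
noncomputable def expansion₃ (A B C : SmallIndex → R) : Grassmann R :=
  -(∑ β, symm₃ (.b β) (.a 0) (.a 1) A B C •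
      (th R 0 * th R 1 * thb R β * vt R 0 * vt R 1 * vtb R β))
  - ∑ α, symm₃ (.a α) (.b 0) (.b 1) A B C •
      (th R α * thb R 0 * thb R 1 * vt R α * vtb R 0 * vtb R 1)
  + ∑ α, ∑ β, ∑ μ, (pauliBar μ β α • symm₃ (.vec μ) (.a α) (.b β) A B C) •
      (th R 0 * th R 1 * thb R 0 * thb R 1 * vt R α * vtb R β)
  - (symm₃ .aa (.b 0) (.b 1) A B C + symm₃ (.ab 0 0) (.a 1) (.b 1) A B C
      + symm₃ (.ab 0 1) (.a 1) (.b 0) A B C + symm₃ (.ab 1 0) (.a 0) (.b 1) A B C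
      + symm₃ (.ab 1 1) (.a 0) (.b 0) A B C + symm₃ .bb (.a 0) (.a 1) A B C) •
      (th R 0 * th R 1 * thb R 0 * thb R 1 * vt R 0 * vt R 1 * vtb R 0 * vtb R 1)

/-- The right-hand side of the expansion of the product of four elements without degree-zero
component. -/
noncomputable def expansion₄ (A B C D : SmallIndex → R) : Grassmann R :=
  (symm₂ (.a 0) (.a 1) A B * symm₂ (.b 0) (.b 1) C D
    + symm₂ (.b 0) (.b 1) A B * symm₂ (.a 0) (.a 1) C D
    + ∑ α, ∑ γ, ∑ β, ∑ δ, if α ≠ γ ∧ β ≠ δ then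
        symm₂ (.a α) (.b β) A B * symm₂ (.a γ) (.b δ) C D else 0) •
      (th R 0 * th R 1 * thb R 0 * thb R 1 * vt R 0 * vt R 1 * vtb R 0 * vtb R 1)

end SmallRing

/-! ### Smooth functions, smooth maps from the small towered superspace -/

open TopologicalSpace

/-- Minkowski space-time `X = ℝ^{3+1}` as a smooth manifold. -/
abbrev Spacetime : Type := EuclideanSpace ℝ (Fin 4)

/-- `C^∞(M)^ℂ`: smooth complex-valued functions on an open piece `M` of space-time (or, generally,
on a smooth 4-manifold). -/
def smoothC (M : Type*) [TopologicalSpace M] [ChartedSpace Spacetime M] :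
    Subalgebra ℂ (M → ℂ) where
  carrier := {g | ContMDiff 𝓘(ℝ, Spacetime) 𝓘(ℝ, ℂ) ∞ g}
  mul_mem' := fun {f g} hf hg => by
    have hm : ContDiff ℝ ∞ (fun p : ℂ × ℂ => p.1 * p.2) := contDiff_fst.mul contDiff_snd
    exact hm.contMDiff.comp (hf.prodMk_space hg)
  add_mem' := fun ha hb => ha.add hb
  algebraMap_mem' := fun _ => contMDiff_const

/-- Restriction `C^∞(X)^ℂ → C^∞(U)^ℂ`. -/
def restrictC (U : Opens Spacetime) : smoothC Spacetime →ₐ[ℂ] smoothC U where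
  toFun g := ⟨fun x => g.1 x, ContMDiff.comp g.2 contMDiff_subtype_val⟩
  map_one' := rfl
  map_mul' _ _ := rfl
  map_zero' := rfl
  map_add' _ _ := rfl
  commutes' _ := rfl

/-- Restriction of small superfields from `X` to `U`, component by component. -/
noncomputable def restrictSmall (U : Opens Spacetime) (s : smallRing (smoothC Spacetime)) :
    smallRing (smoothC U) :=
  ∑ k, restrictC U (component k s) • smallElt (smoothC U) k

section Target

variable {n : ℕ} {Y : Type*} [TopologicalSpace Y] [ChartedSpace (EuclideanSpace ℝ (Fin n)) Y]

/-- Restriction `C^∞(Y) → C^∞(V)`. -/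
noncomputable def restrictR (V : Opens Y) (h : C^∞⟮𝓡 n, Y; 𝓘(ℝ), ℝ⟯) : C^∞⟮𝓡 n, V; 𝓘(ℝ), ℝ⟯ :=
  ⟨fun y => h y, h.contMDiff.comp contMDiff_subtype_val⟩

/-- `f^♯ : C^∞(Y) → C^∞(X) ⊆ C^∞(X)^ℂ`, `h ↦ h ∘ f`. -/
noncomputable def pullback (f : C^∞⟮𝓘(ℝ, Spacetime), Spacetime; 𝓡 n, Y⟯)
    (h : C^∞⟮𝓡 n, Y; 𝓘(ℝ), ℝ⟯) :
    smoothC Spacetime :=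
  ⟨fun x => ((h (f x) : ℝ) : ℂ),
    Complex.ofRealCLM.contDiff.contMDiff.comp (h.contMDiff.comp f.contMDiff)⟩

/-- The extension by zero of a function on `V` is smooth at the points of `V`. -/
theorem contMDiffAt_extend_zero (V : Opens Y) (h : C^∞⟮𝓡 n, V; 𝓘(ℝ), ℝ⟯) (y : V) :
    ContMDiffAt (𝓡 n) 𝓘(ℝ) ∞ (Function.extend Subtype.val h 0 : Y → ℝ) y := by
  rw [← contMDiffAt_subtype_iff]
  have : (fun x : V => (Function.extend Subtype.val h 0 : Y → ℝ) x) = h :=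
    funext fun x => Subtype.val_injective.extend_apply _ _ x
  rw [this]
  exact h.contMDiff y

/-- `f^♯ : C^∞(V) → C^∞(U) ⊆ C^∞(U)^ℂ` for open sets with `f(U) ⊆ V`. -/
noncomputable def pullbackOn (f : C^∞⟮𝓘(ℝ, Spacetime), Spacetime; 𝓡 n, Y⟯)
    {U : Opens Spacetime} {V : Opens Y}
    (hUV : Set.MapsTo f U V) (h : C^∞⟮𝓡 n, V; 𝓘(ℝ), ℝ⟯) : smoothC U :=
  ⟨fun x => ((h ⟨f x, hUV x.2⟩ : ℝ) : ℂ), by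
    have : ContMDiff 𝓘(ℝ, Spacetime) 𝓘(ℝ) ∞
        (fun x : U => (Function.extend Subtype.val h 0 : Y → ℝ) (f x)) := fun x =>
      (contMDiffAt_extend_zero V h ⟨f x, hUV x.2⟩).comp x
        ((f.contMDiff.comp contMDiff_subtype_val) x)
    have h2 : (fun x : U => (Function.extend Subtype.val h 0 : Y → ℝ) (f x)) =
        fun x : U => h ⟨f x, hUV x.2⟩ :=
      funext fun x => Subtype.val_injective.extend_apply _ _ (⟨f x, hUV x.2⟩ : V)
    rw [h2] at this
    exact Complex.ofRealCLM.contDiff.contMDiff.comp this⟩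

/-- The domain of a chart as an open set. -/
def chartDomain (φ : OpenPartialHomeomorph Y (EuclideanSpace ℝ (Fin n))) : Opens Y :=
  ⟨φ.source, φ.open_source⟩

variable [IsManifold (𝓡 n) ∞ Y] {φ : OpenPartialHomeomorph Y (EuclideanSpace ℝ (Fin n))}

/-- The coordinate function `y^i ∈ C^∞(V)` of a chart with domain `V`. -/
noncomputable def chartCoord (hφ : φ ∈ IsManifold.maximalAtlas (𝓡 n) ∞ Y) (i : Fin n) :
    C^∞⟮𝓡 n, chartDomain φ; 𝓘(ℝ), ℝ⟯ :=
  ⟨fun y => φ y i, fun y => by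
    have h1 : ContMDiffAt (𝓡 n) (𝓡 n) ∞ φ (y : Y) :=
      (contMDiffOn_of_mem_maximalAtlas hφ).contMDiffAt (φ.open_source.mem_nhds y.2)
    have h2 : ContDiff ℝ ∞ (fun z : EuclideanSpace ℝ (Fin n) => z i) := by fun_prop
    exact h2.contMDiff.contMDiffAt.comp y (contMDiffAt_subtype_iff.2 h1)⟩

/-- The partial derivative `∂_i : C^∞(V) → C^∞(V)` in a chart with domain `V`. (The function is
extended by zero outside `V`; only its values on `V` matter.) -/
noncomputable def chartPartial (hφ : φ ∈ IsManifold.maximalAtlas (𝓡 n) ∞ Y) (i : Fin n)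
    (h : C^∞⟮𝓡 n, chartDomain φ; 𝓘(ℝ), ℝ⟯) : C^∞⟮𝓡 n, chartDomain φ; 𝓘(ℝ), ℝ⟯ :=
  ⟨fun y => fderiv ℝ (fun z => (Function.extend Subtype.val h 0 : Y → ℝ) (φ.symm z)) (φ y)
      (EuclideanSpace.single i 1), fun y => by
    have h1 : ContMDiffAt (𝓡 n) (𝓡 n) ∞ φ (y : Y) :=
      (contMDiffOn_of_mem_maximalAtlas hφ).contMDiffAt (φ.open_source.mem_nhds y.2)
    have h3 : ContMDiffAt (𝓡 n) (𝓡 n) ∞ φ.symm (φ y) :=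
      (contMDiffOn_symm_of_mem_maximalAtlas hφ).contMDiffAt
        (φ.open_target.mem_nhds (φ.map_source y.2))
    have h4 : ContMDiffAt (𝓡 n) 𝓘(ℝ) ∞ (Function.extend Subtype.val h 0 : Y → ℝ)
        (φ.symm (φ y)) := by
      rw [φ.left_inv y.2]
      exact contMDiffAt_extend_zero (chartDomain φ) h y
    have h5 : ContDiffAt ℝ ∞
        (fun z => (Function.extend Subtype.val h 0 : Y → ℝ) (φ.symm z)) (φ y) :=
      (h4.comp (φ y) h3).contDiffAt
    have h6 := (h5.fderiv_right (m := ∞) (by simp)).clm_apply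
      (contDiffAt_const (c := EuclideanSpace.single i (1 : ℝ)))
    exact (contMDiffAt_subtype_iff (U := chartDomain φ)
      (f := fun y : Y => fderiv ℝ (fun z => (Function.extend Subtype.val h 0 : Y → ℝ) (φ.symm z))
        (φ y) (EuclideanSpace.single i 1))).2 (h6.contMDiffAt.comp (y : Y) h1)⟩

/-- Iterated partial derivatives `∂_{i_1} ⋯ ∂_{i_m}` in a chart. -/
noncomputable def chartPartials (hφ : φ ∈ IsManifold.maximalAtlas (𝓡 n) ∞ Y) (I : List (Fin n))
    (h : C^∞⟮𝓡 n, chartDomain φ; 𝓘(ℝ), ℝ⟯) : C^∞⟮𝓡 n, chartDomain φ; 𝓘(ℝ), ℝ⟯ :=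
  I.foldr (chartPartial hφ) h

/-- `D : C^∞(Y) → C^∞(X)^ℂ` is a `C^∞(X)^ℂ`-valued differential operator along `f : X → Y` of order
(at most) `r` without zeroth-order term, i.e. a section of the pull-back along `f` of the sheaf of
differential operators on `Y` of order at most `r` without zeroth-order term, with complex-valued
smooth coefficients: over every open `U ⊆ X` that `f` maps into the domain of a chart,
`D h = ∑_{1 ≤ m ≤ r} ∑_{i_1, …, i_m} c_{i_1 ⋯ i_m} f^♯(∂_{i_1} ⋯ ∂_{i_m} h)` with smooth
coefficients `c` on `U` that do not depend on `h`. -/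
def IsDiffOpAlong (f : C^∞⟮𝓘(ℝ, Spacetime), Spacetime; 𝓡 n, Y⟯) (r : ℕ)
    (D : C^∞⟮𝓡 n, Y; 𝓘(ℝ), ℝ⟯ → smoothC Spacetime) : Prop :=
  ∀ (φ : OpenPartialHomeomorph Y (EuclideanSpace ℝ (Fin n)))
    (hφ : φ ∈ IsManifold.maximalAtlas (𝓡 n) ∞ Y) (U : Opens Spacetime)
    (hU : Set.MapsTo f U (chartDomain φ)),
    ∃ c : ∀ m : ℕ, (Fin m → Fin n) → smoothC U, ∀ h : C^∞⟮𝓡 n, Y; 𝓘(ℝ), ℝ⟯,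
      restrictC U (D h) = ∑ m ∈ Finset.Icc 1 r, ∑ I : Fin m → Fin n,
        c m I * pullbackOn f hU (chartPartials hφ (List.ofFn I) (restrictR (chartDomain φ) h))

end Target

/-- A smooth map from the small towered superspace over `X = ℝ^{3+1}` to `Y`: a smooth map
`f : X → Y` together with a ring homomorphism (over `ℝ`) from `C^∞(Y)` to the small function ring
whose degree-zero component is `f^♯`. -/
structure SmallMap (n : ℕ) (Y : Type*) [TopologicalSpace Y]
    [ChartedSpace (EuclideanSpace ℝ (Fin n)) Y] where
  /-- the underlying smooth map `f` -/
  base : C^∞⟮𝓘(ℝ, Spacetime), Spacetime; 𝓡 n, Y⟯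
  /-- the ring homomorphism -/
  sharp : C^∞⟮𝓡 n, Y; 𝓘(ℝ), ℝ⟯ →ₐ[ℝ] smallRing (smoothC Spacetime)
  component_zero_sharp : ∀ h, component .zero (sharp h) = pullback base h

/-- `g : C^∞(V) → C^∞(Û)^small` is the ring homomorphism over the open sets `V ⊆ Y`, `U ⊆ X` that
a smooth map from the small towered superspace induces: it is compatible with restriction. -/
def SmallMap.IsInducedOn {n : ℕ} {Y : Type*} [TopologicalSpace Y]
    [ChartedSpace (EuclideanSpace ℝ (Fin n)) Y] (F : SmallMap n Y) (V : Opens Y)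
    (U : Opens Spacetime)
    (g : C^∞⟮𝓡 n, V; 𝓘(ℝ), ℝ⟯ →ₐ[ℝ] smallRing (smoothC U)) : Prop :=
  ∀ h, g (restrictR V h) = restrictSmall U (F.sharp h)

end TowSup

open TowSup

namespace TowSup

/-! ### Functoriality of the small function ring in the coefficients -/

section Functoriality

variable {R R' : Type*} [CommRing R] [CommRing R'] [Algebra ℂ R] [Algebra ℂ R']

/-! Every element of `smallGen` is homogeneous in the eight odd generators, and its
`SmallIndex.order` is half its degree. An element without degree-zero component therefore starts in
degree 2, and a product of p of them starts in degree 2p. So the components of order less than p of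
such a product vanish, and a product of five is zero, because degree 10 exceeds 8 (`component_mul₂`,
`component_mul₃`, `component_mul₄`, `mul₅_eq_zero`).

Evaluation at a point x of space-time turns the given homomorphism into an algebra homomorphism
`SmallMap.sharpAt` from functions on Y to the finite-dimensional algebra `smallRing ℂ`. It sends
functions vanishing at f(x) to elements without degree-zero component, hence kills products of five
such functions. A homomorphism of this kind sees only the germ at f(x) (`map_eq_of_eventuallyEq`).
It therefore extends uniquely to functions on an open neighbourhood (`germHom`, `eq_germHom`), and
letting x vary gives the induced homomorphism over V and U (`inducedHom`, `eq_of_isInducedOn`).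

In a chart, Hadamard's lemma applied repeatedly writes a function as its Taylor polynomial of degree
4 plus a remainder with five factors that vanish at the point; the remainder is killed. This is the
Taylor formula (`taylor_euclidean`, `taylor_chart`, `taylor_of_isInducedOn`). Taking components
gives the explicit operators, and the degree count cuts each of them off at its order
(`isDiffOpAlong_component`).

The expansions of the products are a computation in the basis of monomials, where the structure
constants are 0, 1 or -1 and form a finite table (`structConst_eq_sum_factorPairs`). Passing from
monomials to the Pauli basis turns the signs of the table into contractions with ε (`expansion₂_eq`,
`expansion₃_eq`, `expansion₄_eq`). -/

/-- The ring homomorphism of Grassmann algebras induced by a homomorphism of coefficients. -/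
noncomputable def grassmannMap (φ : R →ₐ[ℂ] R') : Grassmann R →+* Grassmann R' :=
  -- The target becomes an algebra over `R` through `φ`, so that the universal property over `R`
  -- applies.
  letI := φ.toRingHom.toAlgebra
  (ExteriorAlgebra.lift R (A := Grassmann R')
    ⟨{ toFun := fun v => ExteriorAlgebra.ι R' fun i => φ (v i)
       map_add' := fun v w => by
        rw [← map_add]; congr 1; ext i; simp
       map_smul' := fun r v => by
        have : (fun i => φ ((r • v) i)) = φ r • fun i => φ (v i) := by ext i; simp
        rw [this, map_smul]
        exact algebraMap_smul R' r (ExteriorAlgebra.ι R' fun i => φ (v i)) },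
      fun v => ExteriorAlgebra.ι_sq_zero _⟩).toRingHom

theorem grassmannMap_oddGen (φ : R →ₐ[ℂ] R') (i : Fin 8) :
    grassmannMap φ (oddGen R i) = oddGen R' i := by
  let := φ.toRingHom.toAlgebra
  refine (ExteriorAlgebra.lift_ι_apply R _ _ _).trans ?_
  change ExteriorAlgebra.ι R' _ = ExteriorAlgebra.ι R' _
  congr 1
  ext j
  rcases eq_or_ne j i with rfl | h <;> simp [*]

theorem grassmannMap_smul (φ : R →ₐ[ℂ] R') (r : R) (x : Grassmann R) :
    grassmannMap φ (r • x) = φ r • grassmannMap φ x := by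
  let := φ.toRingHom.toAlgebra
  refine (map_smul (ExteriorAlgebra.lift R (A := Grassmann R') _) r x).trans ?_
  exact (algebraMap_smul R' r _).symm

theorem grassmannMap_complex_smul (φ : R →ₐ[ℂ] R') (r : ℂ) (x : Grassmann R) :
    grassmannMap φ (r • x) = r • grassmannMap φ x := by
  rw [← algebraMap_smul R r x, grassmannMap_smul, AlgHom.commutes, algebraMap_smul]

/-- The only scalars in the generators are complex numbers, which `φ` fixes. This is why a change of
coefficients carries small superfields to small superfields and acts on each component separately.
-/
theorem grassmannMap_smallGen (φ : R →ₐ[ℂ] R') (k : SmallIndex) :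
    grassmannMap φ (smallGen R k) = smallGen R' k := by
  cases k <;> simp only [smallGen, th, thb, vt, vtb, map_mul, map_sum, map_one,
    grassmannMap_complex_smul, grassmannMap_oddGen]

theorem smallElt_eq_basis (k : SmallIndex) : smallBasis R k = smallElt R k := by
  simp [smallBasis]

theorem sum_component (s : smallRing R) : s = ∑ k, component k s • smallElt R k := by
  conv_lhs => rw [← (smallBasis R).sum_repr s]
  simp only [smallElt_eq_basis]; rfl

theorem coe_sum_component (s : smallRing R) :
    (s : Grassmann R) = ∑ k, component k s • smallGen R k := by
  conv_lhs => rw [sum_component s]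
  push_cast
  rfl

theorem component_smallElt (k l : SmallIndex) :
    component k (smallElt R l) = if l = k then 1 else 0 := by
  rw [component, ← smallElt_eq_basis, Module.Basis.coord_apply, Module.Basis.repr_self,
    Finsupp.single_apply]

theorem component_sum_smul (c : SmallIndex → R) (k : SmallIndex) :
    component k (∑ l, c l • smallElt R l) = c k := by
  simp [component_smallElt]

theorem smallRing_ext {s t : smallRing R} (h : ∀ k, component k s = component k t) : s = t := by
  rw [sum_component s, sum_component t]
  simp only [h]

/-- The ring homomorphism of small function rings induced by a homomorphism of coefficients. -/
noncomputable def smallMap (φ : R →ₐ[ℂ] R') : smallRing R →+* smallRing R' :=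
  ((grassmannMap φ).comp (smallRing R).val.toRingHom).codRestrict (smallRing R') fun s => by
    have : (grassmannMap φ).comp (smallRing R).val.toRingHom s =
        ((∑ k, φ (component k s) • smallElt R' k : smallRing R') : Grassmann R') := by
      change grassmannMap φ (s : Grassmann R) = _
      rw [coe_sum_component s]
      push_cast
      simp only [map_sum, grassmannMap_smul, grassmannMap_smallGen]
      rfl
    rw [this]
    exact Subtype.prop _

theorem smallMap_eq (φ : R →ₐ[ℂ] R') (s : smallRing R) :
    smallMap φ s = ∑ k, φ (component k s) • smallElt R' k := by
  apply Subtype.ext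
  change grassmannMap φ (s : Grassmann R) = _
  rw [coe_sum_component s]
  push_cast
  simp only [map_sum, grassmannMap_smul, grassmannMap_smallGen]
  rfl

theorem component_smallMap (φ : R →ₐ[ℂ] R') (s : smallRing R) (k : SmallIndex) :
    component k (smallMap φ s) = φ (component k s) := by
  rw [smallMap_eq, component_sum_smul]

theorem smallMap_smul (φ : R →ₐ[ℂ] R') (r : R) (s : smallRing R) :
    smallMap φ (r • s) = φ r • smallMap φ s :=
  smallRing_ext fun k => by simp [component_smallMap]

theorem component_algebraMap (r : R) (k : SmallIndex) :
    component k (algebraMap R (smallRing R) r) = if k = .zero then r else 0 := by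
  have h1 : (1 : smallRing R) = smallElt R .zero := rfl
  rw [Algebra.algebraMap_eq_smul_one, map_smul, h1, component_smallElt]
  simp [eq_comm]

end Functoriality

/-! ### The multiplication table of the monomials -/

section Table

/-- Insert a generator into an increasing list of generators, keeping track of the sign. -/
def signedInsert (i : Fin 8) : List (Fin 8) → ℤ × List (Fin 8)
  | [] => (1, [i])
  | j :: t => if i < j then (1, i :: j :: t) else if i = j then (0, j :: t) else
      (-(signedInsert i t).1, j :: (signedInsert i t).2)

/-- Merge two lists of generators, keeping track of the sign. -/
def signedMerge : List (Fin 8) → List (Fin 8) → ℤ × List (Fin 8)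
  | [], l => (1, l)
  | i :: k, l => ((signedMerge k l).1 * (signedInsert i (signedMerge k l).2).1,
      (signedInsert i (signedMerge k l).2).2)

variable (R : Type*) [CommRing R]

theorem oddGen_mul_self (i : Fin 8) : oddGen R i * oddGen R i = 0 :=
  ExteriorAlgebra.ι_sq_zero _

theorem oddGen_mul_swap (i j : Fin 8) : oddGen R i * oddGen R j = -(oddGen R j * oddGen R i) :=
  eq_neg_of_add_eq_zero_left (ExteriorAlgebra.ι_add_mul_swap _ _)

/-- The generator moves to the right past smaller ones, at the cost of one sign per exchange; if it
meets itself, the product is zero. -/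
theorem oddGen_mul_prod (i : Fin 8) (l : List (Fin 8)) :
    oddGen R i * (l.map (oddGen R)).prod =
      (signedInsert i l).1 • ((signedInsert i l).2.map (oddGen R)).prod := by
  induction l with
  | nil => simp [signedInsert]
  | cons j t ih =>
    rw [signedInsert]
    split_ifs with h1 h2
    · simp
    · subst h2
      simp [← mul_assoc, oddGen_mul_self]
    · rw [List.map_cons, List.prod_cons, ← mul_assoc, oddGen_mul_swap, neg_mul, mul_assoc, ih,
        mul_smul_comm, neg_smul]
      simp

theorem prod_mul_prod (k l : List (Fin 8)) :
    (k.map (oddGen R)).prod * (l.map (oddGen R)).prod =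
      (signedMerge k l).1 • ((signedMerge k l).2.map (oddGen R)).prod := by
  induction k with
  | nil => simp [signedMerge]
  | cons i k ih =>
    rw [List.map_cons, List.prod_cons, mul_assoc, ih, mul_smul_comm, oddGen_mul_prod, smul_smul,
      signedMerge]

/-- The coefficient of the monomial `m` in the product of the monomials `k` and `l`. -/
def structConst (k l m : SmallIndex) : ℤ :=
  if (signedMerge (monList k) (monList l)).2 = monList m then
    (signedMerge (monList k) (monList l)).1 else 0

/-- The signed form of the closure of the small monomials under multiplication, checked over all
pairs of the 33 indices. -/
theorem signedMerge_monList (k l : SmallIndex) :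
    (signedMerge (monList k) (monList l)).1 = 0 ∨
      ∃ m, (signedMerge (monList k) (monList l)).2 = monList m := by
  revert k l; decide +kernel

theorem mon_mul_mon (k l : SmallIndex) :
    mon R k * mon R l = ∑ m, structConst k l m • mon R m := by
  rw [← mon_eq, ← mon_eq, prod_mul_prod]
  rcases signedMerge_monList k l with h0 | ⟨m, hm⟩
  · simp [h0, structConst]
  · rw [hm, mon_eq]
    simp [structConst, hm, monList_injective.eq_iff]

theorem sum_mon_mul_sum_mon (a b : SmallIndex → R) :
    (∑ k, a k • mon R k) * (∑ l, b l • mon R l) =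
      ∑ m, (∑ p : SmallIndex × SmallIndex, structConst p.1 p.2 m • (a p.1 * b p.2)) •
        mon R m := by
  rw [Finset.sum_mul_sum, ← Fintype.sum_prod_type']
  simp only [smul_mul_smul_comm, mon_mul_mon, Finset.smul_sum, Finset.sum_smul]
  rw [Finset.sum_comm]
  refine Finset.sum_congr rfl fun m _ => Finset.sum_congr rfl fun p _ => ?_
  rw [smul_comm, smul_assoc]

/-- Every product of two monomials with degree-zero component zero whose result is the monomial `m`,
up to the order of the factors, with its sign. -/
def factorPairs : SmallIndex → List (ℤ × SmallIndex × SmallIndex)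
  | .zero | .a _ | .b _ | .vec _ => []
  | .aa => [(-1, .a 0, .a 1)]
  | .ab α β => [(-1, .a α, .b β)]
  | .bb => [(-1, .b 0, .b 1)]
  | .vecP i => [(![1, 1, -1, -1] i, .a (![0, 0, 1, 1] i), .vec (![2, 3, 0, 1] i))]
  | .vecPP i => [(![-1, 1, -1, 1] i, .b (![0, 1, 0, 1] i), .vec (![1, 0, 3, 2] i))]
  | .zeroT => [(-1, .vec 0, .vec 3), (1, .vec 1, .vec 2)]
  | .aab β => [(1, .aa, .b β), (1, .ab 0 β, .a 1), (1, .ab 1 β, .a 0)]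
  | .abb α => [(1, .bb, .a α), (1, .ab α 0, .b 1), (1, .ab α 1, .b 0)]
  | .vecT i => [(![-1, -1, 1, 1] i, .a (![0, 0, 1, 1] i), .vecPP (![2, 3, 0, 1] i)),
      (![1, -1, 1, -1] i, .b (![0, 1, 0, 1] i), .vecP (![1, 0, 3, 2] i)),
      (![-1, 1, 1, -1] i, .ab (![0, 0, 1, 1] i) (![0, 1, 0, 1] i), .vec (![3, 2, 1, 0] i))]
  | .aabb => [(1, .aa, .bb), (1, .ab 0 0, .ab 1 1), (1, .ab 0 1, .ab 1 0),
      (-1, .aab 0, .b 1), (-1, .aab 1, .b 0), (-1, .abb 0, .a 1), (-1, .abb 1, .a 0)]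

end Table
end TowSup

namespace TowSup

/-! ### Products of elements without degree-zero component, in monomial coordinates -/

section Products

/-- A finite check of the table. All small monomials have even degree and so commute; hence both
orders of a pair carry the same sign. No pair has equal factors, since such a square is zero. -/
theorem structConst_eq_sum_factorPairs (m k l : SmallIndex) (hk : k ≠ .zero) (hl : l ≠ .zero) :
    structConst k l m = ((factorPairs m).map fun t =>
      (if t.2.1 = k ∧ t.2.2 = l then t.1 else 0) +
        if t.2.2 = k ∧ t.2.1 = l then t.1 else 0).sum := by
  revert m k l; decide +kernel

variable {R : Type*} [CommRing R]

/-- The coefficients of the product of two elements without degree-zero component with respect to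
the monomials, in terms of the coefficients of the factors. -/
def mulCoord (a b : SmallIndex → R) (m : SmallIndex) : R :=
  ((factorPairs m).map fun t => t.1 • (a t.2.1 * b t.2.2 + a t.2.2 * b t.2.1)).sum

theorem sum_structConst_eq_mulCoord (a b : SmallIndex → R) (ha : a .zero = 0) (hb : b .zero = 0)
    (m : SmallIndex) :
    ∑ p : SmallIndex × SmallIndex, structConst p.1 p.2 m • (a p.1 * b p.2) = mulCoord a b m := by
  -- In this indicator form the sum over all pairs collapses, for each entry of the table, to its
  -- two orders. Pairs that contain `.zero`, which the table does not cover, contribute nothing by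
  -- `ha` and `hb`.
  have h : ∀ p : SmallIndex × SmallIndex, structConst p.1 p.2 m • (a p.1 * b p.2) =
      ((factorPairs m).map fun t =>
        (if (t.2.1, t.2.2) = p then t.1 • (a p.1 * b p.2) else 0) +
          if (t.2.2, t.2.1) = p then t.1 • (a p.1 * b p.2) else 0).sum := by
    rintro ⟨k, l⟩
    by_cases hk : k = .zero
    · subst hk; simp [ha]
    by_cases hl : l = .zero
    · subst hl; simp [hb]
    rw [structConst_eq_sum_factorPairs m k l hk hl, List.sum_smul, List.map_map]
    congr 1
    refine List.map_congr_left fun t _ => ?_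
    simp only [Function.comp, add_smul, ite_smul, zero_smul, Prod.mk.injEq]
  simp only [h, mulCoord]
  generalize factorPairs m = L
  induction L with
  | nil => simp
  | cons t L ih =>
    simp only [List.map_cons, List.sum_cons, Finset.sum_add_distrib, ih]
    simp [smul_add]

theorem sum_mon_mul_sum_mon_of_zero (a b : SmallIndex → R) (ha : a .zero = 0) (hb : b .zero = 0) :
    (∑ k, a k • mon R k) * (∑ l, b l • mon R l) = ∑ m, mulCoord a b m • mon R m := by
  rw [sum_mon_mul_sum_mon]
  simp only [sum_structConst_eq_mulCoord a b ha hb]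

theorem sum_smallIndex {M : Type*} [AddCommMonoid M] (f : SmallIndex → M) :
    ∑ k, f k = f .zero + (∑ α, f (.a α) + ∑ β, f (.b β) + f .aa + ∑ i, f (.vec i)
      + ∑ α, ∑ β, f (.ab α β) + f .bb + ∑ i, f (.vecP i) + ∑ β, f (.aab β)
      + ∑ i, f (.vecPP i) + ∑ α, f (.abb α) + f .zeroT + ∑ i, f (.vecT i) + f .aabb) := by
  have h : (Finset.univ : Finset SmallIndex).val = SmallIndex.zero ::ₘ
      (((Finset.univ : Finset (Fin 2)).val.map .a + (Finset.univ : Finset (Fin 2)).val.map .b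
      + {.aa} + (Finset.univ : Finset (Fin 4)).val.map .vec
      + (Finset.univ : Finset (Fin 2 × Fin 2)).val.map (fun p => .ab p.1 p.2)
      + {.bb} + (Finset.univ : Finset (Fin 4)).val.map .vecP
      + (Finset.univ : Finset (Fin 2)).val.map .aab + (Finset.univ : Finset (Fin 4)).val.map .vecPP
      + (Finset.univ : Finset (Fin 2)).val.map .abb + {.zeroT}
      + (Finset.univ : Finset (Fin 4)).val.map .vecT) + {.aabb}) := by
    decide +kernel
  rw [← Fintype.sum_prod_type' (f := fun α β => f (.ab α β))]
  simp only [Finset.sum, h, Multiset.map_cons, Multiset.sum_cons, Multiset.map_add,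
    Multiset.sum_add, Multiset.map_map, Multiset.map_singleton, Multiset.sum_singleton]
  rfl

variable [Algebra ℂ R]

/-- The coefficients with respect to the monomials of a small superfield with components `A`. -/
noncomputable def toMon (A : SmallIndex → R) : SmallIndex → R
  | .vec i => ∑ μ, vecCoef μ i • A (.vec μ)
  | .vecP i => ∑ μ, vecCoefL μ i • A (.vecP μ)
  | .vecPP i => ∑ μ, vecCoefR μ i • A (.vecPP μ)
  | .vecT i => ∑ μ, vecCoefB μ i • A (.vecT μ)
  | k => A k

/-- The change from `smallGen` to monomials mixes only the four members of each vectorial family, by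
the corresponding table of Pauli coefficients. -/
theorem sum_smul_smallGen (A : SmallIndex → R) :
    ∑ k, A k • smallGen R k = ∑ k, toMon A k • mon R k := by
  have hv : ∀ (c : Fin 4 → Fin 4 → ℂ) (B : Fin 4 → R) (G : Fin 4 → Grassmann R),
      ∑ μ, B μ • ∑ i, algebraMap ℂ R (c μ i) • G i = ∑ i, (∑ μ, c μ i • B μ) • G i := by
    intro c B G
    simp only [Finset.smul_sum, Finset.sum_smul]
    rw [Finset.sum_comm]
    simp only [smul_smul, Algebra.smul_def (A := R), mul_comm]
  simp only [sum_smallIndex, smallGen_eq, toMon, hv]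

end Products
end TowSup

namespace TowSup

/-! ### The monomials in the notation of the expansions -/

section Monomials

variable (R : Type*) [CommRing R]

/-- The number of the pair `(α, β̇)` in the vectorial families. -/
def pairIndex (α β : Fin 2) : Fin 4 := ![![0, 1], ![2, 3]] α β

theorem sum_pairIndex {M : Type*} [AddCommMonoid M] (f : Fin 4 → M) :
    ∑ i, f i = ∑ α, ∑ β, f (pairIndex α β) := by
  simp [Fin.sum_univ_two, Fin.sum_univ_four, pairIndex, add_assoc]

theorem mon_aa : th R 0 * th R 1 * vt R 0 * vt R 1 = mon R .aa := by
  simp [← mon_eq, monList, th, vt, mul_assoc]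

theorem mon_ab (α β : Fin 2) : th R α * thb R β * vt R α * vtb R β = mon R (.ab α β) := by
  simp [← mon_eq, monList, th, thb, vt, vtb, mul_assoc]

theorem mon_bb : thb R 0 * thb R 1 * vtb R 0 * vtb R 1 = mon R .bb := by
  simp [← mon_eq, monList, thb, vtb, mul_assoc]

theorem mon_vecP (α β : Fin 2) :
    th R 0 * th R 1 * thb R β * vt R α = mon R (.vecP (pairIndex α β)) := by
  fin_cases α <;> fin_cases β <;>
    simp [← mon_eq, monList, th, thb, vt, pairIndex, mul_assoc]

theorem mon_aab (β : Fin 2) :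
    th R 0 * th R 1 * thb R β * vt R 0 * vt R 1 * vtb R β = mon R (.aab β) := by
  simp [← mon_eq, monList, th, thb, vt, vtb, mul_assoc]

theorem mon_vecPP (α β : Fin 2) :
    th R α * thb R 0 * thb R 1 * vtb R β = mon R (.vecPP (pairIndex α β)) := by
  fin_cases α <;> fin_cases β <;>
    simp [← mon_eq, monList, th, thb, vtb, pairIndex, mul_assoc]

theorem mon_abb (α : Fin 2) :
    th R α * thb R 0 * thb R 1 * vt R α * vtb R 0 * vtb R 1 = mon R (.abb α) := by
  simp [← mon_eq, monList, th, thb, vt, vtb, mul_assoc]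

theorem mon_zeroT : th R 0 * th R 1 * thb R 0 * thb R 1 = mon R .zeroT := by
  simp [← mon_eq, monList, th, thb, mul_assoc]

theorem mon_vecT (α β : Fin 2) :
    th R 0 * th R 1 * thb R 0 * thb R 1 * vt R α * vtb R β =
      mon R (.vecT (pairIndex α β)) := by
  fin_cases α <;> fin_cases β <;>
    simp [← mon_eq, monList, th, thb, vt, vtb, pairIndex, mul_assoc]

theorem mon_aabb :
    th R 0 * th R 1 * thb R 0 * thb R 1 * vt R 0 * vt R 1 * vtb R 0 * vtb R 1 =
      mon R .aabb := by
  simp [← mon_eq, monList, th, thb, vt, vtb, mul_assoc]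

end Monomials

/-! ### Twofold products and the appearance of the Pauli matrices -/

section Coefficients

variable {R : Type*} [CommRing R]

theorem mulCoord_aa (a b : SmallIndex → R) :
    mulCoord a b .aa = -(a (.a 0) * b (.a 1) + a (.a 1) * b (.a 0)) := by
  simp [mulCoord, factorPairs]; ring

theorem mulCoord_ab (a b : SmallIndex → R) (α β : Fin 2) :
    mulCoord a b (.ab α β) = -(a (.a α) * b (.b β) + a (.b β) * b (.a α)) := by
  simp [mulCoord, factorPairs]; ring

theorem mulCoord_bb (a b : SmallIndex → R) :
    mulCoord a b .bb = -(a (.b 0) * b (.b 1) + a (.b 1) * b (.b 0)) := by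
  simp [mulCoord, factorPairs]; ring

theorem mulCoord_aab (a b : SmallIndex → R) (β : Fin 2) :
    mulCoord a b (.aab β) = a .aa * b (.b β) + a (.ab 0 β) * b (.a 1) + a (.ab 1 β) * b (.a 0)
      + a (.a 0) * b (.ab 1 β) + a (.a 1) * b (.ab 0 β) + a (.b β) * b .aa := by
  simp [mulCoord, factorPairs]; ring

theorem mulCoord_abb (a b : SmallIndex → R) (α : Fin 2) :
    mulCoord a b (.abb α) = a .bb * b (.a α) + a (.ab α 0) * b (.b 1) + a (.ab α 1) * b (.b 0)
      + a (.b 0) * b (.ab α 1) + a (.b 1) * b (.ab α 0) + a (.a α) * b .bb := by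
  simp [mulCoord, factorPairs]; ring

theorem mulCoord_aabb (a b : SmallIndex → R) :
    mulCoord a b .aabb = -(a (.aab 0) * b (.b 1)) - a (.aab 1) * b (.b 0)
      - a (.abb 0) * b (.a 1) - a (.abb 1) * b (.a 0)
      + a .aa * b .bb + a (.ab 0 0) * b (.ab 1 1) + a (.ab 0 1) * b (.ab 1 0)
      + a (.ab 1 0) * b (.ab 0 1) + a (.ab 1 1) * b (.ab 0 0) + a .bb * b .aa
      - a (.a 0) * b (.abb 1) - a (.a 1) * b (.abb 0)
      - a (.b 0) * b (.aab 1) - a (.b 1) * b (.aab 0) := by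
  simp [mulCoord, factorPairs]; ring

/-- The exchange of the two values of a spinor index. -/
def flip₂ (α : Fin 2) : Fin 2 := ![1, 0] α

/-- The sign `ε^{12} = 1`, `ε^{21} = -1`, as an integer. -/
def sign₂ (α : Fin 2) : ℤ := ![1, -1] α

/-- A factor with θ^α ϑ_α must be completed by the other θ, hence `flip₂`; reordering the generators
gives the sign of ε. -/
theorem mulCoord_vecP (a b : SmallIndex → R) (α β : Fin 2) :
    mulCoord a b (.vecP (pairIndex α β)) = sign₂ α •
      (a (.a α) * b (.vec (pairIndex (flip₂ α) β))
        + a (.vec (pairIndex (flip₂ α) β)) * b (.a α)) := by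
  fin_cases α <;> fin_cases β <;> simp [mulCoord, factorPairs, pairIndex, sign₂, flip₂]

theorem mulCoord_vecPP (a b : SmallIndex → R) (α β : Fin 2) :
    mulCoord a b (.vecPP (pairIndex α β)) = -(sign₂ β •
      (a (.b β) * b (.vec (pairIndex α (flip₂ β)))
        + a (.vec (pairIndex α (flip₂ β))) * b (.b β))) := by
  fin_cases α <;> fin_cases β <;> simp [mulCoord, factorPairs, pairIndex, sign₂, flip₂] <;> ring

theorem mulCoord_zeroT (a b : SmallIndex → R) :
    mulCoord a b .zeroT = -(a (.vec 0) * b (.vec 3) + a (.vec 3) * b (.vec 0))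
      + (a (.vec 1) * b (.vec 2) + a (.vec 2) * b (.vec 1)) := by
  simp [mulCoord, factorPairs]; ring

theorem mulCoord_vecT (a b : SmallIndex → R) (α β : Fin 2) :
    mulCoord a b (.vecT (pairIndex α β)) =
      -(sign₂ α • (a (.a α) * b (.vecPP (pairIndex (flip₂ α) β))
        + a (.vecPP (pairIndex (flip₂ α) β)) * b (.a α)))
      + sign₂ β • (a (.b β) * b (.vecP (pairIndex α (flip₂ β)))
        + a (.vecP (pairIndex α (flip₂ β))) * b (.b β))
      - (sign₂ α * sign₂ β) • (a (.ab α β) * b (.vec (pairIndex (flip₂ α) (flip₂ β)))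
        + a (.vec (pairIndex (flip₂ α) (flip₂ β))) * b (.ab α β)) := by
  fin_cases α <;> fin_cases β <;> simp [mulCoord, factorPairs, pairIndex, sign₂, flip₂] <;> ring

theorem mulCoord_of_order_lt {a b : SmallIndex → R} {m : SmallIndex} (h : m.order < 2) :
    mulCoord a b m = 0 := by
  cases m <;> first | rfl | simp [SmallIndex.order] at h

variable [Algebra ℂ R]

/-- Exchanging the values of a spinor index with the sign `sign₂` is contraction with ε, since ε has
one nonzero entry in each row. The combinatorial signs of the product thus raise indices of the
Pauli matrices; the next four lemmas are the other cases. -/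
theorem vecCoef_flip_left (μ : Fin 4) (α β : Fin 2) :
    sign₂ α • vecCoef μ (pairIndex (flip₂ α) β) = pauliL μ α β := by
  fin_cases α <;> fin_cases β <;> simp [vecCoef, pauliL, epsUp, pairIndex, sign₂, flip₂]

theorem vecCoef_flip_right (μ : Fin 4) (α β : Fin 2) :
    sign₂ β • vecCoef μ (pairIndex α (flip₂ β)) = pauliR μ α β := by
  fin_cases α <;> fin_cases β <;> simp [vecCoef, pauliR, epsUp, pairIndex, sign₂, flip₂]

theorem vecCoef_flip_both (μ : Fin 4) (α β : Fin 2) :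
    (sign₂ α * sign₂ β) • vecCoef μ (pairIndex (flip₂ α) (flip₂ β)) = pauliBar μ β α := by
  fin_cases α <;> fin_cases β <;> simp [vecCoef, pauliBar, epsUp, pairIndex, sign₂, flip₂]

theorem vecCoefL_flip_right (μ : Fin 4) (α β : Fin 2) :
    sign₂ β • vecCoefL μ (pairIndex α (flip₂ β)) = pauliBar μ β α := by
  fin_cases α <;> fin_cases β <;>
    simp [vecCoefL, pauliL, pauliBar, epsUp, pairIndex, sign₂, flip₂]

theorem vecCoefR_flip_left (μ : Fin 4) (α β : Fin 2) :
    sign₂ α • vecCoefR μ (pairIndex (flip₂ α) β) = pauliBar μ β α := by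
  fin_cases α <;> fin_cases β <;>
    simp [vecCoefR, pauliR, pauliBar, epsUp, pairIndex, sign₂, flip₂]

theorem sign_smul_sum {c : Fin 4 → ℂ} {d : Fin 4 → ℂ} {s : ℤ} (h : ∀ μ, s • c μ = d μ)
    (x : Fin 4 → R) (p : R) :
    s • (p * ∑ μ, c μ • x μ) = ∑ μ, d μ • (p * x μ) := by
  simp only [← h, Finset.mul_sum, Finset.smul_sum, mul_smul_comm, smul_assoc]

theorem sign_smul_symm {c : Fin 4 → ℂ} {d : Fin 4 → ℂ} {s : ℤ} (h : ∀ μ, s • c μ = d μ)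
    (x y : Fin 4 → R) (p q : R) :
    s • (p * (∑ μ, c μ • x μ) + (∑ μ, c μ • y μ) * q) = ∑ μ, d μ • (p * x μ + y μ * q) := by
  simp only [mul_comm _ q, smul_add, sign_smul_sum h, Finset.sum_add_distrib]

theorem mulCoord_toMon_vecP (A B : SmallIndex → R) (α β : Fin 2) :
    mulCoord (toMon A) (toMon B) (.vecP (pairIndex α β)) =
      ∑ μ, pauliL μ α β • (A (.a α) * B (.vec μ) + A (.vec μ) * B (.a α)) := by
  rw [mulCoord_vecP, ← sign_smul_symm fun μ => vecCoef_flip_left μ α β]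
  rfl

theorem mulCoord_toMon_vecPP (A B : SmallIndex → R) (α β : Fin 2) :
    mulCoord (toMon A) (toMon B) (.vecPP (pairIndex α β)) =
      -∑ μ, pauliR μ α β • (A (.b β) * B (.vec μ) + A (.vec μ) * B (.b β)) := by
  rw [mulCoord_vecPP, ← sign_smul_symm fun μ => vecCoef_flip_right μ α β]
  rfl

/-- On 2×2 matrices the left-hand side is the polarisation of -det, and the determinant of ∑ x_μ σ^μ
is minus the Minkowski square of x. Polarising gives the factor 2. -/
theorem mulCoord_toMon_zeroT (A B : SmallIndex → R) :
    mulCoord (toMon A) (toMon B) .zeroT =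
      2 * ∑ μ, ∑ ν, minkowski μ ν • (A (.vec μ) * B (.vec ν)) := by
  -- Used for μ = 2 only, the one Pauli matrix with imaginary entries.
  have hI : algebraMap ℂ R Complex.I ^ 2 = -1 := by
    rw [← map_pow, Complex.I_sq, map_neg, map_one]
  rw [mulCoord_zeroT]
  simp [toMon, vecCoef, pauli, minkowski, Fin.sum_univ_four, Algebra.smul_def,
    Matrix.diagonal_apply]
  linear_combination (-2 * A (.vec 2) * B (.vec 2)) * hI

/-- Three kinds of factor pairs contribute: (α) with '', (β̇) with ', and (αβ̇) with [μ]. The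
missing indices are raised on `vecCoefR`, `vecCoefL` and `vecCoef` respectively, and each time the
result is `pauliBar`. -/
theorem mulCoord_toMon_vecT (A B : SmallIndex → R) (α β : Fin 2) :
    mulCoord (toMon A) (toMon B) (.vecT (pairIndex α β)) =
      ∑ μ, pauliBar μ β α •
        (-(A (.a α) * B (.vecPP μ)) + A (.b β) * B (.vecP μ) - A (.ab α β) * B (.vec μ)
          - A (.vecPP μ) * B (.a α) + A (.vecP μ) * B (.b β) - A (.vec μ) * B (.ab α β)) := by
  have h1 := sign_smul_symm (fun μ => vecCoefR_flip_left μ α β) (fun μ => B (.vecPP μ))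
    (fun μ => A (.vecPP μ)) (A (.a α)) (B (.a α))
  have h2 := sign_smul_symm (fun μ => vecCoefL_flip_right μ α β) (fun μ => B (.vecP μ))
    (fun μ => A (.vecP μ)) (A (.b β)) (B (.b β))
  have h3 := sign_smul_symm (fun μ => vecCoef_flip_both μ α β) (fun μ => B (.vec μ))
    (fun μ => A (.vec μ)) (A (.ab α β)) (B (.ab α β))
  rw [mulCoord_vecT]
  refine (congrArg₂ _ (congrArg₂ _ (congrArg _ h1) h2) h3).trans ?_
  rw [← Finset.sum_neg_distrib, ← Finset.sum_add_distrib, ← Finset.sum_sub_distrib]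
  refine Finset.sum_congr rfl fun μ _ => ?_
  rw [← smul_neg, ← smul_add, ← smul_sub]
  congr 1
  ring

theorem sum_mulCoord_vecP (A B : SmallIndex → R) :
    ∑ i, mulCoord (toMon A) (toMon B) (.vecP i) • mon R (.vecP i) =
      ∑ β, ∑ α, (∑ μ, pauliL μ α β • (A (.a α) * B (.vec μ) + A (.vec μ) * B (.a α))) •
        mon R (.vecP (pairIndex α β)) := by
  rw [sum_pairIndex, Finset.sum_comm]
  simp only [mulCoord_toMon_vecP]

theorem sum_mulCoord_vecPP (A B : SmallIndex → R) :
    ∑ i, mulCoord (toMon A) (toMon B) (.vecPP i) • mon R (.vecPP i) =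
      ∑ α, -∑ β, (∑ μ, pauliR μ α β • (A (.b β) * B (.vec μ) + A (.vec μ) * B (.b β))) •
        mon R (.vecPP (pairIndex α β)) := by
  rw [sum_pairIndex]
  simp only [mulCoord_toMon_vecPP, neg_smul, Finset.sum_neg_distrib]

theorem sum_mulCoord_vecT (A B : SmallIndex → R) :
    ∑ i, mulCoord (toMon A) (toMon B) (.vecT i) • mon R (.vecT i) =
      ∑ α, ∑ β, (∑ μ, pauliBar μ β α •
        (-(A (.a α) * B (.vecPP μ)) + A (.b β) * B (.vecP μ) - A (.ab α β) * B (.vec μ)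
          - A (.vecPP μ) * B (.a α) + A (.vecP μ) * B (.b β) - A (.vec μ) * B (.ab α β))) •
        mon R (.vecT (pairIndex α β)) := by
  rw [sum_pairIndex]
  simp only [mulCoord_toMon_vecT]

theorem sum_mulCoord_smul_mon (a b : SmallIndex → R) :
    ∑ m, mulCoord a b m • mon R m = mulCoord a b .aa • mon R .aa
      + ∑ α, ∑ β, mulCoord a b (.ab α β) • mon R (.ab α β) + mulCoord a b .bb • mon R .bb
      + ∑ i, mulCoord a b (.vecP i) • mon R (.vecP i)
      + ∑ β, mulCoord a b (.aab β) • mon R (.aab β)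
      + ∑ i, mulCoord a b (.vecPP i) • mon R (.vecPP i)
      + ∑ α, mulCoord a b (.abb α) • mon R (.abb α) + mulCoord a b .zeroT • mon R .zeroT
      + ∑ i, mulCoord a b (.vecT i) • mon R (.vecT i) + mulCoord a b .aabb • mon R .aabb := by
  have h0 : ∀ m : SmallIndex, m.order < 2 → mulCoord a b m • mon R m = 0 :=
    fun m hm => by rw [mulCoord_of_order_lt hm, zero_smul]
  rw [sum_smallIndex, h0 .zero (by decide), Fintype.sum_eq_zero _ fun α => h0 (.a α) one_lt_two,
    Fintype.sum_eq_zero _ fun β => h0 (.b β) one_lt_two,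
    Fintype.sum_eq_zero _ fun μ => h0 (.vec μ) one_lt_two]
  simp only [zero_add, add_zero]

theorem expansion₂_eq (A B : SmallIndex → R) :
    expansion₂ A B = ∑ m, mulCoord (toMon A) (toMon B) m • mon R m := by
  rw [sum_mulCoord_smul_mon, sum_mulCoord_vecP, sum_mulCoord_vecPP, sum_mulCoord_vecT,
    mulCoord_toMon_zeroT, mulCoord_aa, mulCoord_bb, mulCoord_aabb]
  simp only [mulCoord_ab, mulCoord_aab, mulCoord_abb, toMon]
  simp only [expansion₂, mon_aa, mon_aabb, mon_aab, mon_abb, mon_bb]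
  simp only [mon_vecT, mon_vecP, mon_vecPP, mon_ab]
  simp only [mon_zeroT, ← Finset.sum_smul, neg_smul, Finset.sum_add_distrib,
    Finset.sum_neg_distrib]
  abel

end Coefficients
end TowSup

namespace TowSup

/-! ### Threefold, fourfold and fivefold products in monomial coordinates -/

section HigherProducts

variable {R : Type*} [CommRing R]

/-- In each entry of `factorPairs` the orders of the factors add up to the order of the result, and
indices of order below 2 have no entry. Three factors hence reach order 3 at least; four and five
factors behave likewise below. -/
theorem mulCoord_mulCoord_of_order_lt {a b c : SmallIndex → R} {m : SmallIndex}
    (h : m.order < 3) : mulCoord (mulCoord a b) c m = 0 := by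
  cases m <;> first
    | (simp [SmallIndex.order] at h; done)
    | simp [mulCoord, factorPairs]

theorem mulCoord_mulCoord_aab (a b c : SmallIndex → R) (β : Fin 2) :
    mulCoord (mulCoord a b) c (.aab β) = -symm₃ (.b β) (.a 0) (.a 1) a b c := by
  simp [mulCoord, factorPairs, symm₃, symm₂]; ring

theorem mulCoord_mulCoord_abb (a b c : SmallIndex → R) (α : Fin 2) :
    mulCoord (mulCoord a b) c (.abb α) = -symm₃ (.a α) (.b 0) (.b 1) a b c := by
  simp [mulCoord, factorPairs, symm₃, symm₂]; ring

theorem mulCoord_mulCoord_aabb (a b c : SmallIndex → R) :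
    mulCoord (mulCoord a b) c .aabb =
      -(symm₃ .aa (.b 0) (.b 1) a b c + symm₃ (.ab 0 0) (.a 1) (.b 1) a b c
      + symm₃ (.ab 0 1) (.a 1) (.b 0) a b c + symm₃ (.ab 1 0) (.a 0) (.b 1) a b c
      + symm₃ (.ab 1 1) (.a 0) (.b 0) a b c + symm₃ .bb (.a 0) (.a 1) a b c) := by
  simp [mulCoord, factorPairs, symm₃, symm₂]; ring

/-- By degree each factor contributes a monomial of order 1, and four θ's with only two ϑ's leave
one vector, one (α) and one (β̇). The two signs of ε come from the vector taking the remaining pair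
of indices. -/
theorem mulCoord_mulCoord_vecT (a b c : SmallIndex → R) (α β : Fin 2) :
    mulCoord (mulCoord a b) c (.vecT (pairIndex α β)) = (sign₂ α * sign₂ β) •
      symm₃ (.vec (pairIndex (flip₂ α) (flip₂ β))) (.a α) (.b β) a b c := by
  fin_cases α <;> fin_cases β <;>
    simp [mulCoord, factorPairs, symm₃, symm₂, pairIndex, sign₂, flip₂] <;> ring

/-- Each factor must contribute a monomial of order 1, and all four ϑ's are needed, so no vector
component enters. What remains are the 24 ways to distribute (1), (2), (1̇), (2̇) over the factors,
grouped by what the first two receive. -/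
theorem mulCoord_mulCoord_mulCoord_aabb (a b c d : SmallIndex → R) :
    mulCoord (mulCoord (mulCoord a b) c) d .aabb =
      symm₂ (.a 0) (.a 1) a b * symm₂ (.b 0) (.b 1) c d
    + symm₂ (.b 0) (.b 1) a b * symm₂ (.a 0) (.a 1) c d
    + ∑ α, ∑ γ, ∑ β, ∑ δ, if α ≠ γ ∧ β ≠ δ then
        symm₂ (.a α) (.b β) a b * symm₂ (.a γ) (.b δ) c d else 0 := by
  simp [mulCoord, factorPairs, symm₂, Fin.sum_univ_two]; ring

theorem mulCoord_mulCoord_mulCoord_of_order_lt {a b c d : SmallIndex → R} {m : SmallIndex}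
    (h : m.order < 4) : mulCoord (mulCoord (mulCoord a b) c) d m = 0 := by
  cases m <;> first
    | (simp [SmallIndex.order] at h; done)
    | simp [mulCoord, factorPairs]

theorem mulCoord_mulCoord_mulCoord_mulCoord (a b c d e : SmallIndex → R) (m : SmallIndex) :
    mulCoord (mulCoord (mulCoord (mulCoord a b) c) d) e m = 0 := by
  cases m <;> first | rfl | simp [mulCoord, factorPairs]

variable [Algebra ℂ R]

theorem mulCoord_mulCoord_toMon_vecT (A B C : SmallIndex → R) (α β : Fin 2) :
    mulCoord (mulCoord (toMon A) (toMon B)) (toMon C) (.vecT (pairIndex α β)) =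
      ∑ μ, pauliBar μ β α • symm₃ (.vec μ) (.a α) (.b β) A B C := by
  have h (D : SmallIndex → R) (p : R) :=
    sign_smul_sum (fun μ => vecCoef_flip_both μ α β) (fun μ => D (.vec μ)) p
  rw [mulCoord_mulCoord_vecT]
  simp only [symm₃, smul_add, Finset.sum_add_distrib, mul_comm _ (symm₂ _ _ _ _), ← h]
  rfl

theorem expansion₃_eq (A B C : SmallIndex → R) :
    expansion₃ A B C =
      ∑ m, mulCoord (mulCoord (toMon A) (toMon B)) (toMon C) m • mon R m := by
  have h0 : ∀ m : SmallIndex, m.order < 3 →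
      mulCoord (mulCoord (toMon A) (toMon B)) (toMon C) m • mon R m = 0 :=
    fun m hm => by rw [mulCoord_mulCoord_of_order_lt hm, zero_smul]
  have h2 : ∀ (f : Fin 4 → SmallIndex), (∀ i, (f i).order = 2) →
      ∑ i, mulCoord (mulCoord (toMon A) (toMon B)) (toMon C) (f i) • mon R (f i) = 0 :=
    fun f hf => Fintype.sum_eq_zero _ fun i => h0 _ (by rw [hf]; norm_num)
  rw [sum_mulCoord_smul_mon, h0 .aa (by decide), h0 .bb (by decide), h0 .zeroT (by decide),
    h2 .vecP fun _ => rfl, h2 .vecPP fun _ => rfl, Finset.sum_eq_zero fun α _ =>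
      Finset.sum_eq_zero fun β _ => h0 (.ab α β) (by decide : 2 < 3), sum_pairIndex]
  simp only [mulCoord_mulCoord_toMon_vecT, mulCoord_mulCoord_aab, mulCoord_mulCoord_abb,
    mulCoord_mulCoord_aabb]
  simp only [expansion₃, mon_aabb, mon_aab, mon_abb]
  simp only [mon_vecT, ← Finset.sum_smul, neg_smul, Finset.sum_neg_distrib, symm₃, symm₂, toMon]
  abel

theorem expansion₄_eq (A B C D : SmallIndex → R) :
    expansion₄ A B C D = ∑ m, mulCoord (mulCoord (mulCoord (toMon A) (toMon B)) (toMon C))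
      (toMon D) m • mon R m := by
  rw [Finset.sum_eq_single .aabb, mulCoord_mulCoord_mulCoord_aabb, expansion₄, mon_aabb]
  · simp only [symm₂, toMon]
  · intro m _ hm
    rw [mulCoord_mulCoord_mulCoord_of_order_lt, zero_smul]
    cases m <;> simp [SmallIndex.order] at hm ⊢
  · simp

end HigherProducts

/-! ### Products of elements of the small function ring -/

section SmallProducts

variable {R : Type*} [CommRing R] [Algebra ℂ R]

/-- The coefficients of a small superfield with respect to the monomials. -/
noncomputable def coord (s : smallRing R) : SmallIndex → R := toMon fun k => component k s

theorem coe_eq_sum_coord (s : smallRing R) :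
    (s : Grassmann R) = ∑ k, coord s k • mon R k := by
  rw [coe_sum_component, sum_smul_smallGen]
  rfl

theorem component_eq_dualGen (s : smallRing R) (k : SmallIndex) :
    component k s = dualGen R k s := by
  rw [coe_sum_component]
  simp [dualGen_smallGen]

/-- Passing from monomials to components mixes only indices of the same order, so vanishing below a
given order does not depend on the basis. -/
theorem component_eq_zero_of_coord {s : smallRing R} {b : SmallIndex → R}
    (h : (s : Grassmann R) = ∑ k, b k • mon R k) {p : ℕ} (hb : ∀ k, k.order < p → b k = 0)
    {k : SmallIndex} (hk : k.order < p) : component k s = 0 := by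
  have h0 : ∀ l : SmallIndex, l.order < p → (monBasis R).coord (monSupp l) (s : Grassmann R) = 0 := by
    intro l hl
    rw [h, map_sum]
    simp only [map_smul, mon_repr, smul_eq_mul, mul_ite, mul_one, mul_zero]
    simp [hb l hl]
  rw [component_eq_dualGen]
  cases k
  case vec => simp [dualGen, fun i => h0 (.vec i) hk]
  case vecP => simp [dualGen, fun i => h0 (.vecP i) hk]
  case vecPP => simp [dualGen, fun i => h0 (.vecPP i) hk]
  case vecT => simp [dualGen, fun i => h0 (.vecT i) hk]
  all_goals exact h0 _ hk

variable {x y z w v : smallRing R}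

theorem coe_mul₂ (hx : component .zero x = 0) (hy : component .zero y = 0) :
    ((x * y : smallRing R) : Grassmann R) = ∑ m, mulCoord (coord x) (coord y) m • mon R m := by
  rw [Subalgebra.coe_mul, coe_eq_sum_coord x, coe_eq_sum_coord y]
  exact sum_mon_mul_sum_mon_of_zero _ _ hx hy

theorem coe_mul₃ (hx : component .zero x = 0) (hy : component .zero y = 0)
    (hz : component .zero z = 0) :
    ((x * y * z : smallRing R) : Grassmann R) =
      ∑ m, mulCoord (mulCoord (coord x) (coord y)) (coord z) m • mon R m := by
  rw [Subalgebra.coe_mul, coe_mul₂ hx hy, coe_eq_sum_coord z]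
  exact sum_mon_mul_sum_mon_of_zero _ _ rfl hz

theorem coe_mul₄ (hx : component .zero x = 0) (hy : component .zero y = 0)
    (hz : component .zero z = 0) (hw : component .zero w = 0) :
    ((x * y * z * w : smallRing R) : Grassmann R) =
      ∑ m, mulCoord (mulCoord (mulCoord (coord x) (coord y)) (coord z)) (coord w) m •
        mon R m := by
  rw [Subalgebra.coe_mul, coe_mul₃ hx hy hz, coe_eq_sum_coord w]
  exact sum_mon_mul_sum_mon_of_zero _ _ rfl hw

/-- Degree at least 10 in eight odd generators. This nilpotency makes the Taylor expansion stop at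
order four. -/
theorem mul₅_eq_zero (hx : component .zero x = 0) (hy : component .zero y = 0)
    (hz : component .zero z = 0) (hw : component .zero w = 0) (hv : component .zero v = 0) :
    x * y * z * w * v = 0 := by
  apply Subtype.ext
  rw [Subalgebra.coe_mul, coe_mul₄ hx hy hz hw, coe_eq_sum_coord v,
    sum_mon_mul_sum_mon_of_zero _ (coord v) rfl hv]
  simp [mulCoord_mulCoord_mulCoord_mulCoord]

theorem component_mul₂ (hx : component .zero x = 0) (hy : component .zero y = 0)
    {s : SmallIndex} (hs : s.order < 2) : component s (x * y) = 0 :=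
  component_eq_zero_of_coord (coe_mul₂ hx hy) (fun _ => mulCoord_of_order_lt) hs

theorem component_mul₃ (hx : component .zero x = 0) (hy : component .zero y = 0)
    (hz : component .zero z = 0) {s : SmallIndex} (hs : s.order < 3) :
    component s (x * y * z) = 0 :=
  component_eq_zero_of_coord (coe_mul₃ hx hy hz) (fun _ => mulCoord_mulCoord_of_order_lt) hs

theorem component_mul₄ (hx : component .zero x = 0) (hy : component .zero y = 0)
    (hz : component .zero z = 0) (hw : component .zero w = 0) {s : SmallIndex}
    (hs : s.order < 4) : component s (x * y * z * w) = 0 :=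
  component_eq_zero_of_coord (coe_mul₄ hx hy hz hw)
    (fun _ => mulCoord_mulCoord_mulCoord_of_order_lt) hs

end SmallProducts
end TowSup

namespace TowSup

/-! ### Smoothness of integrals depending on a parameter -/

section ParametricIntegral

variable {E : Type*} [NormedAddCommGroup E] [NormedSpace ℝ E]

/-- Differentiation under the integral sign. In finite dimension the closed unit ball times the
interval is compact, which bounds the derivative by a constant. -/
theorem hasFDerivAt_intervalIntegral_of_contDiff {F : E × ℝ → ℝ} (hF : ContDiff ℝ ∞ F) (a b : ℝ)
    [FiniteDimensional ℝ E] (x : E) :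
    HasFDerivAt (fun x => ∫ t in a..b, F (x, t))
      (∫ t in a..b, (fderiv ℝ F (x, t)).comp (.inl ℝ E ℝ)) x := by
  have hF' : Continuous fun p : E × ℝ => (fderiv ℝ F p).comp (.inl ℝ E ℝ) :=
    (hF.continuous_fderiv (by simp)).clm_comp continuous_const
  have hK : IsCompact (Metric.closedBall x 1 ×ˢ Set.uIcc a b) :=
    (isCompact_closedBall x 1).prod isCompact_uIcc
  obtain ⟨C, hC⟩ := hK.exists_bound_of_continuousOn hF'.continuousOn
  refine intervalIntegral.hasFDerivAt_integral_of_dominated_of_fderiv_le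
    (F := fun x t => F (x, t)) (F' := fun x t => (fderiv ℝ F (x, t)).comp (.inl ℝ E ℝ))
    (bound := fun _ => C) (Metric.closedBall_mem_nhds x one_pos) ?_ ?_ ?_ ?_ ?_ ?_
  · exact Filter.Eventually.of_forall fun y =>
      (hF.continuous.comp (Continuous.prodMk_right y)).aestronglyMeasurable
  · exact (hF.continuous.comp (Continuous.prodMk_right x)).intervalIntegrable a b
  · exact (hF'.comp (Continuous.prodMk_right x)).aestronglyMeasurable
  · exact Filter.Eventually.of_forall fun t ht y hy => hC (y, t) ⟨hy, Set.uIoc_subset_uIcc ht⟩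
  · exact intervalIntegrable_const
  · refine Filter.Eventually.of_forall fun t _ y _ => ?_
    exact ((hF.differentiable (by simp)) (y, t)).hasFDerivAt.comp y (hasFDerivAt_prodMk_left y t)

theorem contDiff_intervalIntegral [FiniteDimensional ℝ E] {F : E × ℝ → ℝ} (hF : ContDiff ℝ ∞ F)
    (a b : ℝ) : ContDiff ℝ ∞ fun x => ∫ t in a..b, F (x, t) := by
  rw [contDiff_infty]
  intro m
  induction m generalizing F with
  | zero =>
    rw [Nat.cast_zero, contDiff_zero]
    exact intervalIntegral.continuous_parametric_intervalIntegral_of_continuous'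
      (f := fun x t => F (x, t)) hF.continuous a b
  -- Each directional derivative is again the integral of a smooth function, so the induction has to
  -- run over all `F`.
  | succ m ih =>
    rw [Nat.cast_succ, contDiff_succ_iff_fderiv_apply]
    refine ⟨fun x => (hasFDerivAt_intervalIntegral_of_contDiff hF a b x).differentiableAt,
      fun h => by simp at h, fun y => ?_⟩
    have h : (fun x => fderiv ℝ (fun x => ∫ t in a..b, F (x, t)) x y) =
        fun x => ∫ t in a..b, fderiv ℝ F (x, t) (y, 0) := by
      ext x
      rw [(hasFDerivAt_intervalIntegral_of_contDiff hF a b x).fderiv,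
        ContinuousLinearMap.intervalIntegral_apply]
      · simp
      · exact (((hF.continuous_fderiv (by simp)).clm_comp continuous_const).comp
          (Continuous.prodMk_right x)).intervalIntegrable a b
    rw [h]
    exact ih ((hF.fderiv_right (m := ∞) (by simp)).clm_apply contDiff_const)

end ParametricIntegral

/-! ### Hadamard's lemma and its iteration -/

section Hadamard

variable {n : ℕ}

/-- The partial derivative of a function of `n` variables. -/
noncomputable def partialDeriv (i : Fin n) (G : EuclideanSpace ℝ (Fin n) → ℝ)
    (z : EuclideanSpace ℝ (Fin n)) : ℝ :=
  fderiv ℝ G z (EuclideanSpace.single i 1)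

theorem contDiff_partialDeriv {G : EuclideanSpace ℝ (Fin n) → ℝ} (hG : ContDiff ℝ ∞ G)
    (i : Fin n) : ContDiff ℝ ∞ (partialDeriv i G) :=
  (hG.fderiv_right (m := ∞) (by simp)).clm_apply contDiff_const

/-- The weighted mean of `G` along the segment from `z₀` to `z` that occurs in the remainder of the
Taylor formula. -/
noncomputable def segmentMean (z₀ : EuclideanSpace ℝ (Fin n)) (k : ℕ)
    (G : EuclideanSpace ℝ (Fin n) → ℝ) (z : EuclideanSpace ℝ (Fin n)) : ℝ :=
  ∫ t in (0 : ℝ)..1, (1 - t) ^ k * G (z₀ + t • (z - z₀))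

variable (z₀ : EuclideanSpace ℝ (Fin n)) {G : EuclideanSpace ℝ (Fin n) → ℝ}

theorem contDiff_segmentMean (hG : ContDiff ℝ ∞ G) (k : ℕ) :
    ContDiff ℝ ∞ (segmentMean z₀ k G) := by
  refine contDiff_intervalIntegral (F := fun p : EuclideanSpace ℝ (Fin n) × ℝ =>
    (1 - p.2) ^ k * G (z₀ + p.2 • (p.1 - z₀))) ?_ 0 1
  fun_prop

theorem fderiv_apply_eq_sum (z v : EuclideanSpace ℝ (Fin n)) :
    fderiv ℝ G z v = ∑ i, partialDeriv i G z * v i := by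
  conv_lhs => rw [← (EuclideanSpace.basisFun (Fin n) ℝ).sum_repr v]
  simp [partialDeriv, mul_comm]

theorem hasDerivAt_segment (hG : ContDiff ℝ ∞ G) (z : EuclideanSpace ℝ (Fin n)) (t : ℝ) :
    HasDerivAt (fun t : ℝ => G (z₀ + t • (z - z₀)))
      (∑ i, partialDeriv i G (z₀ + t • (z - z₀)) * (z i - z₀ i)) t := by
  have h1 : HasDerivAt (fun t : ℝ => z₀ + t • (z - z₀)) (z - z₀) t := by
    simpa using ((hasDerivAt_id t).smul_const (z - z₀)).const_add z₀
  have h2 := ((hG.differentiable (by simp)) (z₀ + t • (z - z₀))).hasFDerivAt.comp_hasDerivAt t h1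
  rw [fderiv_apply_eq_sum] at h2
  exact h2.congr_deriv (by simp)

theorem continuous_segment (hG : ContDiff ℝ ∞ G) (z : EuclideanSpace ℝ (Fin n)) :
    Continuous fun t : ℝ => G (z₀ + t • (z - z₀)) := by
  have := hG.continuous
  fun_prop

/-- The fundamental theorem of calculus along the segment from `z₀` to `z`. -/
theorem eq_add_sum_segmentMean (hG : ContDiff ℝ ∞ G) (z : EuclideanSpace ℝ (Fin n)) :
    G z = G z₀ + ∑ i, segmentMean z₀ 0 (partialDeriv i G) z * (z i - z₀ i) := by
  have hc (i : Fin n) := continuous_segment z₀ (contDiff_partialDeriv hG i) z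
  have h := intervalIntegral.integral_eq_sub_of_hasDerivAt (a := 0) (b := 1)
    (fun t _ => hasDerivAt_segment z₀ hG z t)
    (Continuous.intervalIntegrable (by fun_prop) _ _)
  rw [intervalIntegral.integral_finsetSum
    fun i _ => Continuous.intervalIntegrable (by fun_prop) _ _] at h
  simp only [intervalIntegral.integral_mul_const, one_smul, zero_smul, add_zero,
    add_sub_cancel] at h
  simp only [segmentMean, pow_zero, one_mul, h, add_sub_cancel]

/-- Integration by parts. Successive factors 1/(k+1) build up the factorials of Taylor's formula. -/
theorem segmentMean_eq_add_sum (hG : ContDiff ℝ ∞ G) (k : ℕ) (z : EuclideanSpace ℝ (Fin n)) :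
    segmentMean z₀ k G z = (k + 1 : ℝ)⁻¹ *
      (G z₀ + ∑ i, segmentMean z₀ (k + 1) (partialDeriv i G) z * (z i - z₀ i)) := by
  have hc (i : Fin n) := continuous_segment z₀ (contDiff_partialDeriv hG i) z
  have hc' := continuous_segment z₀ hG z
  have hk : (k + 1 : ℝ) ≠ 0 := by positivity
  -- This antiderivative vanishes at t = 1, so the only boundary term is the value at `z₀`.
  have hu (t : ℝ) : HasDerivAt (fun t : ℝ => -(1 - t) ^ (k + 1)) ((k + 1) * (1 - t) ^ k) t := by
    exact (((hasDerivAt_id t).const_sub 1).pow (k + 1)).neg.congr_deriv (by simp)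
  have h := intervalIntegral.integral_deriv_mul_eq_sub (a := 0) (b := 1)
    (fun t _ => hu t) (fun t _ => hasDerivAt_segment z₀ hG z t)
    (Continuous.intervalIntegrable (by fun_prop) _ _)
    (Continuous.intervalIntegrable (by fun_prop) _ _)
  rw [intervalIntegral.integral_add (Continuous.intervalIntegrable (by fun_prop) _ _)
    (Continuous.intervalIntegrable (by fun_prop) _ _)] at h
  simp only [Finset.mul_sum, neg_mul, mul_assoc, intervalIntegral.integral_const_mul,
    Finset.sum_neg_distrib, intervalIntegral.integral_neg] at h
  rw [intervalIntegral.integral_finsetSum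
    fun i _ => Continuous.intervalIntegrable (by fun_prop) _ _] at h
  simp only [← mul_assoc, intervalIntegral.integral_mul_const] at h
  simp only [sub_self, ne_eq, Nat.add_eq_zero_iff, one_ne_zero, and_false, not_false_eq_true,
    zero_pow, neg_zero, zero_mul, sub_zero, one_pow, one_mul, zero_smul, add_zero] at h
  rw [eq_inv_mul_iff_mul_eq₀ hk]
  simp only [segmentMean]
  linarith

end Hadamard
end TowSup

namespace TowSup

open TopologicalSpace Filter Topology

/-! ### Cut-off functions and dependence on germs -/

section Germs

variable {n : ℕ} {M : Type*} [TopologicalSpace M] [ChartedSpace (EuclideanSpace ℝ (Fin n)) M]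
  [T2Space M] [IsManifold (𝓡 n) ∞ M]

theorem exists_bump {y : M} {W : Set M} (hW : W ∈ 𝓝 y) :
    ∃ χ : C^∞⟮𝓡 n, M; 𝓘(ℝ), ℝ⟯, χ =ᶠ[𝓝 y] 1 ∧ tsupport χ ⊆ W := by
  obtain ⟨f, -, hf⟩ := (SmoothBumpFunction.nhds_basis_tsupport (I := 𝓡 n) (c := y)).mem_iff.1 hW
  exact ⟨⟨f, f.contMDiff⟩, f.eventuallyEq_one, hf⟩

theorem exists_contMDiffMap_eventuallyEq {y : M} {W : Set M} (hW : W ∈ 𝓝 y) {f : M → ℝ}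
    (hf : ∀ x ∈ W, ContMDiffAt (𝓡 n) 𝓘(ℝ) ∞ f x) :
    ∃ H : C^∞⟮𝓡 n, M; 𝓘(ℝ), ℝ⟯, H =ᶠ[𝓝 y] f := by
  obtain ⟨χ, hχ, hχW⟩ := exists_bump (n := n) hW
  refine ⟨⟨fun x => χ x * f x, contMDiff_of_tsupport fun x hx => ?_⟩, ?_⟩
  · exact (χ.contMDiff x).mul (hf x (hχW (tsupport_mul_subset_left hx)))
  · filter_upwards [hχ] with x hx
    change χ x * f x = f x
    rw [hx, Pi.one_apply, one_mul]

/-- An algebra homomorphism that kills products of five functions vanishing at `y` depends only on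
the germ of a function at `y`. -/
theorem map_eq_of_eventuallyEq {S : Type*} [Ring S] [Algebra ℝ S]
    (Ψ : C^∞⟮𝓡 n, M; 𝓘(ℝ), ℝ⟯ →ₐ[ℝ] S) (y : M)
    (hΨ : ∀ h₁ h₂ h₃ h₄ h₅ : C^∞⟮𝓡 n, M; 𝓘(ℝ), ℝ⟯, h₁ y = 0 → h₂ y = 0 → h₃ y = 0 → h₄ y = 0 →
      h₅ y = 0 → Ψ h₁ * Ψ h₂ * Ψ h₃ * Ψ h₄ * Ψ h₅ = 0)
    {h h' : C^∞⟮𝓡 n, M; 𝓘(ℝ), ℝ⟯} (hh : h =ᶠ[𝓝 y] h') : Ψ h = Ψ h' := by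
  obtain ⟨χ, hχ, hχW⟩ := exists_bump (n := n) hh
  have h0 : (h - h') * χ = 0 := by
    ext x
    change (h x - h' x) * χ x = 0
    by_cases hx : x ∈ tsupport χ
    · have : h x = h' x := hχW hx
      rw [this, sub_self, zero_mul]
    · rw [image_eq_zero_of_notMem_tsupport hx, mul_zero]
  have hψ : (1 - χ) y = 0 := by
    change 1 - χ y = 0
    rw [hχ.eq_of_nhds, Pi.one_apply, sub_self]
  -- Since `χ` annihilates `h - h'`, multiplication by `1 - χ` leaves it unchanged. The polynomial
  -- below is (1 - (1 - χ)^5)/χ.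
  have h1 : h - h' = (h - h') * ((1 - χ) * (1 - χ) * (1 - χ) * (1 - χ) * (1 - χ)) := by
    linear_combination (-(χ ^ 4) + 5 * χ ^ 3 - 10 * χ ^ 2 + 10 * χ - 5) * (-1) * h0
  have h2 : Ψ (h - h') = 0 := by
    rw [h1, map_mul, map_mul, map_mul, map_mul, map_mul, hΨ _ _ _ _ _ hψ hψ hψ hψ hψ, mul_zero]
  rwa [map_sub, sub_eq_zero] at h2

end Germs

/-! ### Taylor's formula for homomorphisms on functions of n variables -/

section TaylorEuclidean

variable {n : ℕ} {S : Type*} [Ring S] [Algebra ℝ S]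

/-- Iterated partial derivatives of a function of `n` variables. -/
noncomputable def partialDerivs (I : List (Fin n)) (G : EuclideanSpace ℝ (Fin n) → ℝ) :
    EuclideanSpace ℝ (Fin n) → ℝ :=
  I.foldr partialDeriv G

theorem contMDiffMap_sum_apply {M : Type*} [TopologicalSpace M]
    [ChartedSpace (EuclideanSpace ℝ (Fin n)) M] {ι : Type*} (s : Finset ι)
    (f : ι → C^∞⟮𝓡 n, M; 𝓘(ℝ), ℝ⟯) (y : M) : (∑ i ∈ s, f i) y = ∑ i ∈ s, f i y :=
  map_sum (ContMDiffMap.evalRingHom y) f s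

theorem sum_reverse₂ {ι M : Type*} [Fintype ι] [AddCommMonoid M] (f : ι → ι → M) :
    ∑ i, ∑ j, f i j = ∑ i, ∑ j, f j i :=
  Finset.sum_comm

theorem sum_reverse₃ {ι M : Type*} [Fintype ι] [AddCommMonoid M] (f : ι → ι → ι → M) :
    ∑ i, ∑ j, ∑ k, f i j k = ∑ i, ∑ j, ∑ k, f k j i := by
  conv_lhs => enter [2, i]; rw [Finset.sum_comm]
  rw [Finset.sum_comm]
  exact Finset.sum_congr rfl fun i _ => Finset.sum_comm

theorem sum_reverse₄ {ι M : Type*} [Fintype ι] [AddCommMonoid M] (f : ι → ι → ι → ι → M) :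
    ∑ i, ∑ j, ∑ k, ∑ l, f i j k l = ∑ i, ∑ j, ∑ k, ∑ l, f l k j i := by
  conv_lhs => enter [2, i]; rw [sum_reverse₃]
  rw [Finset.sum_comm]
  refine Finset.sum_congr rfl fun i _ => ?_
  rw [Finset.sum_comm]
  exact Finset.sum_congr rfl fun j _ => Finset.sum_comm

/-- Hadamard's lemma once and its refinement four times express `H` by Taylor terms and a smooth
remainder times five coordinate differences. `Φ` respects this identity in the ring of functions and
kills the remainder. -/
theorem taylor_euclidean
    (Φ : C^∞⟮𝓡 n, EuclideanSpace ℝ (Fin n); 𝓘(ℝ), ℝ⟯ →ₐ[ℝ] S) (z₀ : EuclideanSpace ℝ (Fin n))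
    (hΦ : ∀ h₁ h₂ h₃ h₄ h₅ : C^∞⟮𝓡 n, EuclideanSpace ℝ (Fin n); 𝓘(ℝ), ℝ⟯, h₁ z₀ = 0 →
      h₂ z₀ = 0 → h₃ z₀ = 0 → h₄ z₀ = 0 → h₅ z₀ = 0 → Φ h₁ * Φ h₂ * Φ h₃ * Φ h₄ * Φ h₅ = 0)
    (x : Fin n → C^∞⟮𝓡 n, EuclideanSpace ℝ (Fin n); 𝓘(ℝ), ℝ⟯) (hx : ∀ i z, x i z = z i - z₀ i)
    (H : C^∞⟮𝓡 n, EuclideanSpace ℝ (Fin n); 𝓘(ℝ), ℝ⟯) :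
    Φ H = algebraMap ℝ S (H z₀) + ∑ i, partialDerivs [i] H z₀ • Φ (x i)
      + (1 / 2 : ℝ) • ∑ i, ∑ j, partialDerivs [i, j] H z₀ • (Φ (x i) * Φ (x j))
      + (1 / 6 : ℝ) • ∑ i, ∑ j, ∑ k, partialDerivs [i, j, k] H z₀ •
          (Φ (x i) * Φ (x j) * Φ (x k))
      + (1 / 24 : ℝ) • ∑ i, ∑ j, ∑ k, ∑ l, partialDerivs [i, j, k, l] H z₀ •
          (Φ (x i) * Φ (x j) * Φ (x k) * Φ (x l)) := by
  have hx0 (i : Fin n) : x i z₀ = 0 := by rw [hx, sub_self]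
  have hd (I : List (Fin n)) : ContDiff ℝ ∞ (partialDerivs I H) := by
    induction I with
    | nil => exact H.contMDiff.contDiff
    | cons i I ih => exact contDiff_partialDeriv ih i
  let mean (k : ℕ) (I : List (Fin n)) : C^∞⟮𝓡 n, EuclideanSpace ℝ (Fin n); 𝓘(ℝ), ℝ⟯ :=
    ⟨segmentMean z₀ k (partialDerivs I H), (contDiff_segmentMean z₀ (hd I) k).contMDiff⟩
  have start : Φ H = algebraMap ℝ S (H z₀) + ∑ i, Φ (mean 0 [i]) * Φ (x i) := by
    have : H = algebraMap ℝ _ (H z₀) + ∑ i, mean 0 [i] * x i := by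
      ext z
      refine (eq_add_sum_segmentMean z₀ H.contMDiff.contDiff z).trans ?_
      rw [ContMDiffMap.coe_add, Pi.add_apply, contMDiffMap_sum_apply]
      simp only [ContMDiffMap.coe_mul, Pi.mul_apply, hx]
      rfl
    conv_lhs => rw [this]
    simp [map_sum]
  have step (k : ℕ) (I : List (Fin n)) : Φ (mean k I) = (k + 1 : ℝ)⁻¹ •
      (algebraMap ℝ S (partialDerivs I H z₀) + ∑ i, Φ (mean (k + 1) (i :: I)) * Φ (x i)) := by
    have : mean k I = (k + 1 : ℝ)⁻¹ • (algebraMap ℝ _ (partialDerivs I H z₀)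
        + ∑ i, mean (k + 1) (i :: I) * x i) := by
      ext z
      refine (segmentMean_eq_add_sum z₀ (hd I) k z).trans ?_
      rw [ContMDiffMap.coe_smul, Pi.smul_apply, ContMDiffMap.coe_add, Pi.add_apply,
        contMDiffMap_sum_apply]
      simp only [ContMDiffMap.coe_mul, Pi.mul_apply, hx]
      rfl
    rw [this]
    simp [map_sum]
  have step0 (I : List (Fin n)) := step 0 I
  have step1 (I : List (Fin n)) := step 1 I
  have step2 (I : List (Fin n)) := step 2 I
  have step3 (I : List (Fin n)) := step 3 I
  norm_num only at step0 step1 step2 step3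
  have last (i j k l m : Fin n) : Φ (mean 4 [m, l, k, j, i]) * Φ (x m) * Φ (x l) * Φ (x k) *
      Φ (x j) * Φ (x i) = 0 := by
    have := hΦ (x m) (x l) (x k) (x j) (x i) (hx0 m) (hx0 l) (hx0 k) (hx0 j) (hx0 i)
    simp only [mul_assoc] at this ⊢
    rw [this, mul_zero]
  -- Each step puts the newest index first, so the multi-indices arise reversed relative to the
  -- nesting of the sums. Since `S` need not be commutative, the sums are reordered instead of the
  -- factors.
  rw [start, sum_reverse₂, sum_reverse₃, sum_reverse₄]
  simp only [step0, step1, step2, step3, Finset.sum_mul, add_mul, smul_mul_assoc, smul_add,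
    Finset.sum_add_distrib, last, Finset.sum_const_zero, smul_zero, add_zero, Finset.smul_sum,
    smul_smul, ← Algebra.smul_def, one_smul, ← mul_assoc]
  norm_num [add_assoc]

end TaylorEuclidean
-- Taylor's formula in a chart
section TaylorChart

variable {n : ℕ} {Y : Type*} [TopologicalSpace Y] [T2Space Y]
  [ChartedSpace (EuclideanSpace ℝ (Fin n)) Y] [IsManifold (𝓡 n) ∞ Y]
  {φ : OpenPartialHomeomorph Y (EuclideanSpace ℝ (Fin n))}

/-- Composition with a chart with domain `V`, as a homomorphism `C^∞(ℝⁿ) → C^∞(V)`. -/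
noncomputable def compChart (hφ : φ ∈ IsManifold.maximalAtlas (𝓡 n) ∞ Y) :
    C^∞⟮𝓡 n, EuclideanSpace ℝ (Fin n); 𝓘(ℝ), ℝ⟯ →ₐ[ℝ] C^∞⟮𝓡 n, chartDomain φ; 𝓘(ℝ), ℝ⟯ where
  toFun H := ⟨fun y => H (φ y), fun y =>
    H.contMDiff.contMDiffAt.comp y (contMDiffAt_subtype_iff.2
      ((contMDiffOn_of_mem_maximalAtlas hφ).contMDiffAt (φ.open_source.mem_nhds y.2)))⟩
  map_one' := rfl
  map_mul' _ _ := rfl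
  map_zero' := rfl
  map_add' _ _ := rfl
  commutes' _ := rfl

/-- The representation of a function on a chart domain in coordinates (extended by zero). -/
noncomputable def chartRep (h : C^∞⟮𝓡 n, chartDomain φ; 𝓘(ℝ), ℝ⟯)
    (z : EuclideanSpace ℝ (Fin n)) : ℝ :=
  (Function.extend Subtype.val h 0 : Y → ℝ) (φ.symm z)

theorem extend_apply {V : Opens Y} (h : C^∞⟮𝓡 n, V; 𝓘(ℝ), ℝ⟯) (y : V) :
    (Function.extend Subtype.val h 0 : Y → ℝ) y = h y :=
  Subtype.val_injective.extend_apply _ _ y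

theorem chartRep_apply (h : C^∞⟮𝓡 n, chartDomain φ; 𝓘(ℝ), ℝ⟯) (y : chartDomain φ) :
    chartRep h (φ y) = h y := by
  rw [chartRep, φ.left_inv y.2, extend_apply]

theorem contMDiffAt_chartRep (hφ : φ ∈ IsManifold.maximalAtlas (𝓡 n) ∞ Y)
    (h : C^∞⟮𝓡 n, chartDomain φ; 𝓘(ℝ), ℝ⟯) {z : EuclideanSpace ℝ (Fin n)} (hz : z ∈ φ.target) :
    ContMDiffAt (𝓡 n) 𝓘(ℝ) ∞ (chartRep h) z :=
  (contMDiffAt_extend_zero (chartDomain φ) h ⟨φ.symm z, φ.map_target hz⟩).comp z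
    ((contMDiffOn_symm_of_mem_maximalAtlas hφ).contMDiffAt (φ.open_target.mem_nhds hz))

/-- A derivative depends only on the germ, so agreement near the point, as opposed to agreement at
it, survives every further derivative. -/
theorem chartRep_chartPartials_eventuallyEq (hφ : φ ∈ IsManifold.maximalAtlas (𝓡 n) ∞ Y)
    (h : C^∞⟮𝓡 n, chartDomain φ; 𝓘(ℝ), ℝ⟯) {z₀ : EuclideanSpace ℝ (Fin n)} (hz₀ : z₀ ∈ φ.target)
    {H : EuclideanSpace ℝ (Fin n) → ℝ} (hH : H =ᶠ[𝓝 z₀] chartRep h) (I : List (Fin n)) :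
    partialDerivs I H =ᶠ[𝓝 z₀] chartRep (chartPartials hφ I h) := by
  induction I with
  | nil => exact hH
  | cons i I ih =>
    filter_upwards [ih.eventually_nhds, φ.open_target.mem_nhds hz₀] with z hz hzt
    have h1 := chartRep_apply (chartPartials hφ (i :: I) h) ⟨φ.symm z, φ.map_target hzt⟩
    simp only [φ.right_inv hzt] at h1
    rw [h1]
    change fderiv ℝ (partialDerivs I H) z _ =
      fderiv ℝ (chartRep (chartPartials hφ I h)) (φ (φ.symm z)) _
    rw [φ.right_inv hzt, EventuallyEq.fderiv_eq hz]

/-- A function on the chart domain need not extend to ℝⁿ, but some `H` on ℝⁿ has the same germ at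
the point. `Ψ` does not distinguish the two, and the Euclidean formula applies to `Ψ` composed with
the chart. -/
theorem taylor_chart {S : Type*} [Ring S] [Algebra ℝ S]
    (hφ : φ ∈ IsManifold.maximalAtlas (𝓡 n) ∞ Y) (y : chartDomain φ)
    (Ψ : C^∞⟮𝓡 n, chartDomain φ; 𝓘(ℝ), ℝ⟯ →ₐ[ℝ] S)
    (hΨ : ∀ h₁ h₂ h₃ h₄ h₅ : C^∞⟮𝓡 n, chartDomain φ; 𝓘(ℝ), ℝ⟯, h₁ y = 0 → h₂ y = 0 →
      h₃ y = 0 → h₄ y = 0 → h₅ y = 0 → Ψ h₁ * Ψ h₂ * Ψ h₃ * Ψ h₄ * Ψ h₅ = 0)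
    (ν : Fin n → S) (hν : ∀ i, ν i = Ψ (chartCoord hφ i) - algebraMap ℝ S (chartCoord hφ i y))
    (h : C^∞⟮𝓡 n, chartDomain φ; 𝓘(ℝ), ℝ⟯) :
    Ψ h = algebraMap ℝ S (h y) + ∑ i, chartPartials hφ [i] h y • ν i
      + (1 / 2 : ℝ) • ∑ i, ∑ j, chartPartials hφ [i, j] h y • (ν i * ν j)
      + (1 / 6 : ℝ) • ∑ i, ∑ j, ∑ k, chartPartials hφ [i, j, k] h y • (ν i * ν j * ν k)
      + (1 / 24 : ℝ) • ∑ i, ∑ j, ∑ k, ∑ l, chartPartials hφ [i, j, k, l] h y •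
          (ν i * ν j * ν k * ν l) := by
  have hy : φ y ∈ φ.target := φ.map_source y.2
  obtain ⟨H, hH⟩ := exists_contMDiffMap_eventuallyEq (n := n) (φ.open_target.mem_nhds hy)
    fun z hz => contMDiffAt_chartRep hφ h hz
  have hΨH : Ψ h = Ψ (compChart hφ H) := by
    refine map_eq_of_eventuallyEq Ψ y hΨ ?_
    have hc : Tendsto (fun y : chartDomain φ => φ y) (𝓝 y) (𝓝 (φ y)) :=
      (φ.continuousAt y.2).comp continuousAt_subtype_val
    filter_upwards [hc.eventually hH] with y' hy'
    rw [← chartRep_apply h y', ← hy']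
    rfl
  have hd (I : List (Fin n)) : chartPartials hφ I h y = partialDerivs I H (φ y) := by
    rw [← chartRep_apply, (chartRep_chartPartials_eventuallyEq hφ h hy hH I).eq_of_nhds]
  let x (i : Fin n) : C^∞⟮𝓡 n, EuclideanSpace ℝ (Fin n); 𝓘(ℝ), ℝ⟯ :=
    ⟨fun z => z i - φ y i,
      (show ContDiff ℝ ∞ fun z : EuclideanSpace ℝ (Fin n) => z i - φ y i by fun_prop).contMDiff⟩
  have hx (i : Fin n) : Ψ (compChart hφ (x i)) = ν i := by
    rw [hν, ← Ψ.commutes, ← map_sub]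
    rfl
  have hT := taylor_euclidean (Ψ.comp (compChart hφ)) (φ y)
    (fun h₁ h₂ h₃ h₄ h₅ e₁ e₂ e₃ e₄ e₅ => hΨ _ _ _ _ _ e₁ e₂ e₃ e₄ e₅) x (fun _ _ => rfl) H
  simp only [AlgHom.comp_apply, hx, ← hd] at hT
  rw [hΨH, hT]
  congr 5
  exact hH.eq_of_nhds.trans (chartRep_apply h y)

end TaylorChart
end TowSup

namespace TowSup

open TopologicalSpace Filter Topology

/-! ### Evaluation of superfields at points of space-time -/

section Evaluation

theorem smallMap_algebraMap {R R' : Type*} [CommRing R] [CommRing R'] [Algebra ℂ R] [Algebra ℂ R']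
    (φ : R →ₐ[ℂ] R') (r : R) :
    smallMap φ (algebraMap R (smallRing R) r) = algebraMap R' (smallRing R') (φ r) := by
  rw [Algebra.algebraMap_eq_smul_one, Algebra.algebraMap_eq_smul_one, smallMap_smul, map_one]

theorem smallMap_complex_smul {R R' : Type*} [CommRing R] [CommRing R'] [Algebra ℂ R]
    [Algebra ℂ R'] (φ : R →ₐ[ℂ] R') (c : ℂ) (s : smallRing R) :
    smallMap φ (c • s) = c • smallMap φ s := by
  rw [← algebraMap_smul R c s, smallMap_smul, AlgHom.commutes, algebraMap_smul]

variable {M : Type*} [TopologicalSpace M] [ChartedSpace Spacetime M]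

/-- Evaluation of complex-valued smooth functions at a point. -/
def evalC (x : M) : smoothC M →ₐ[ℂ] ℂ := (Pi.evalAlgHom ℂ (fun _ => ℂ) x).comp (smoothC M).val

/-- Evaluation of small superfields at a point of space-time. -/
noncomputable def evalSmall (x : M) : smallRing (smoothC M) →ₐ[ℝ] smallRing ℂ where
  toRingHom := smallMap (evalC x)
  commutes' t := smallMap_algebraMap (evalC x) (algebraMap ℝ (smoothC M) t)

theorem component_evalSmall (x : M) (s : smallRing (smoothC M)) (k : SmallIndex) :
    component k (evalSmall x s) = (component k s).1 x :=
  component_smallMap _ _ _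

/-- Reduces identities between superfields to single points x, where vanishing at f(x) has a meaning
and gives nilpotency. -/
theorem smallRing_ext_eval {s t : smallRing (smoothC M)}
    (h : ∀ x, evalSmall x s = evalSmall x t) : s = t :=
  smallRing_ext fun k => Subtype.ext <| funext fun x => by
    rw [← component_evalSmall, h, component_evalSmall]

theorem component_restrictSmall (U : Opens Spacetime) (s : smallRing (smoothC Spacetime))
    (k : SmallIndex) : component k (restrictSmall U s) = restrictC U (component k s) :=
  component_sum_smul _ _

theorem evalSmall_restrictSmall (U : Opens Spacetime) (s : smallRing (smoothC Spacetime)) (x : U) :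
    evalSmall x (restrictSmall U s) = evalSmall (x : Spacetime) s :=
  smallRing_ext fun k => by
    rw [component_evalSmall, component_evalSmall, component_restrictSmall]; rfl

end Evaluation

section Pointwise

variable {ι A B C : Type*} [Ring A] [Algebra ℝ A] [Ring B] [Algebra ℝ B] [Ring C] [Algebra ℝ C]

/-- A map that becomes an algebra homomorphism after each of a jointly injective family of algebra
homomorphisms is an algebra homomorphism. -/
def algHomOfPointwise (ev : ι → A →ₐ[ℝ] B) (hev : ∀ s t, (∀ x, ev x s = ev x t) → s = t)
    (Ψ : ι → C →ₐ[ℝ] B) (g : C → A) (hg : ∀ x c, ev x (g c) = Ψ x c) : C →ₐ[ℝ] A where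
  toFun := g
  map_one' := hev _ _ fun x => by rw [hg, map_one, map_one]
  map_mul' a b := hev _ _ fun x => by rw [hg, map_mul, map_mul, hg, hg]
  map_zero' := hev _ _ fun x => by rw [hg, map_zero, map_zero]
  map_add' a b := hev _ _ fun x => by rw [hg, map_add, map_add, hg, hg]
  commutes' t := hev _ _ fun x => by rw [hg, AlgHom.commutes, AlgHom.commutes]

end Pointwise

/-! ### Extension of homomorphisms from Y to open subsets -/

section GermHom

variable {n : ℕ} {Y : Type*} [TopologicalSpace Y] [T2Space Y]
  [ChartedSpace (EuclideanSpace ℝ (Fin n)) Y] [IsManifold (𝓡 n) ∞ Y] {V : Opens Y}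

theorem exists_extension (h : C^∞⟮𝓡 n, V; 𝓘(ℝ), ℝ⟯) (y : V) :
    ∃ H : C^∞⟮𝓡 n, Y; 𝓘(ℝ), ℝ⟯, H =ᶠ[𝓝 (y : Y)] Function.extend Subtype.val h 0 :=
  exists_contMDiffMap_eventuallyEq (V.2.mem_nhds y.2) fun z hz =>
    contMDiffAt_extend_zero V h ⟨z, hz⟩

/-- A function on `Y` with the same germ at `y` as a given function on an open set `V`. -/
noncomputable def extension (h : C^∞⟮𝓡 n, V; 𝓘(ℝ), ℝ⟯) (y : V) : C^∞⟮𝓡 n, Y; 𝓘(ℝ), ℝ⟯ :=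
  (exists_extension h y).choose

theorem extension_eventuallyEq (h : C^∞⟮𝓡 n, V; 𝓘(ℝ), ℝ⟯) (y : V) :
    extension h y =ᶠ[𝓝 (y : Y)] Function.extend Subtype.val h 0 :=
  (exists_extension h y).choose_spec

theorem extension_apply (h : C^∞⟮𝓡 n, V; 𝓘(ℝ), ℝ⟯) (y : V) : extension h y (y : Y) = h y :=
  (extension_eventuallyEq h y).eq_of_nhds.trans (extend_apply h y)

theorem eventuallyEq_extend_of_forall {H : Y → ℝ} {h : C^∞⟮𝓡 n, V; 𝓘(ℝ), ℝ⟯}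
    (e : ∀ y : V, H y = h y) (y : V) : H =ᶠ[𝓝 (y : Y)] Function.extend Subtype.val h 0 := by
  filter_upwards [V.2.mem_nhds y.2] with z hz
  rw [extend_apply h ⟨z, hz⟩, ← e]

theorem extension_restrictR_eventuallyEq (H : C^∞⟮𝓡 n, Y; 𝓘(ℝ), ℝ⟯) (y : V) :
    extension (restrictR V H) y =ᶠ[𝓝 (y : Y)] H :=
  (extension_eventuallyEq _ y).trans (eventuallyEq_extend_of_forall (fun _ => rfl) y).symm

variable {B : Type*} [Ring B] [Algebra ℝ B]

/-- The homomorphism on `C^∞(V)` induced by a homomorphism on `C^∞(Y)` that depends only on the germ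
of functions at a point of `V`. -/
noncomputable def germHom (Φ : C^∞⟮𝓡 n, Y; 𝓘(ℝ), ℝ⟯ →ₐ[ℝ] B) (y : V)
    (hΦ : ∀ h h' : C^∞⟮𝓡 n, Y; 𝓘(ℝ), ℝ⟯, h =ᶠ[𝓝 (y : Y)] h' → Φ h = Φ h') :
    C^∞⟮𝓡 n, V; 𝓘(ℝ), ℝ⟯ →ₐ[ℝ] B where
  toFun h := Φ (extension h y)
  map_one' := by
    rw [← map_one Φ]
    exact hΦ _ _ (extension_restrictR_eventuallyEq 1 y)
  map_mul' h h' := by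
    rw [← map_mul Φ]
    refine hΦ _ _ ?_
    filter_upwards [extension_eventuallyEq h y, extension_eventuallyEq h' y,
      extension_eventuallyEq (h * h') y, V.2.mem_nhds y.2] with z h1 h2 h3 hz
    rw [ContMDiffMap.coe_mul, Pi.mul_apply, h1, h2, h3, extend_apply h ⟨z, hz⟩,
      extend_apply h' ⟨z, hz⟩, extend_apply (h * h') ⟨z, hz⟩]
    rfl
  map_zero' := by
    rw [← map_zero Φ]
    exact hΦ _ _ (extension_restrictR_eventuallyEq 0 y)
  map_add' h h' := by
    rw [← map_add Φ]
    refine hΦ _ _ ?_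
    filter_upwards [extension_eventuallyEq h y, extension_eventuallyEq h' y,
      extension_eventuallyEq (h + h') y, V.2.mem_nhds y.2] with z h1 h2 h3 hz
    rw [ContMDiffMap.coe_add, Pi.add_apply, h1, h2, h3, extend_apply h ⟨z, hz⟩,
      extend_apply h' ⟨z, hz⟩, extend_apply (h + h') ⟨z, hz⟩]
    rfl
  commutes' t := by
    rw [← Φ.commutes t]
    exact hΦ _ _ (extension_restrictR_eventuallyEq (algebraMap ℝ _ t) y)

theorem germHom_apply (Φ : C^∞⟮𝓡 n, Y; 𝓘(ℝ), ℝ⟯ →ₐ[ℝ] B) (y : V)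
    (hΦ : ∀ h h' : C^∞⟮𝓡 n, Y; 𝓘(ℝ), ℝ⟯, h =ᶠ[𝓝 (y : Y)] h' → Φ h = Φ h')
    (h : C^∞⟮𝓡 n, V; 𝓘(ℝ), ℝ⟯) : germHom Φ y hΦ h = Φ (extension h y) := rfl

theorem germHom_restrictR (Φ : C^∞⟮𝓡 n, Y; 𝓘(ℝ), ℝ⟯ →ₐ[ℝ] B) (y : V)
    (hΦ : ∀ h h' : C^∞⟮𝓡 n, Y; 𝓘(ℝ), ℝ⟯, h =ᶠ[𝓝 (y : Y)] h' → Φ h = Φ h')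
    (H : C^∞⟮𝓡 n, Y; 𝓘(ℝ), ℝ⟯) : germHom Φ y hΦ (restrictR V H) = Φ H :=
  hΦ _ _ (extension_restrictR_eventuallyEq H y)

/-- `h` itself need not be a restriction from `Y`, but multiplied by a bump function `χ` near `y` it
agrees with one. `Ψ` sends the restriction of `χ` to 1, as `χ` has the germ of 1, so the factor can
be cancelled. -/
theorem eq_germHom (Φ : C^∞⟮𝓡 n, Y; 𝓘(ℝ), ℝ⟯ →ₐ[ℝ] B) (y : V)
    (hΦ : ∀ h h' : C^∞⟮𝓡 n, Y; 𝓘(ℝ), ℝ⟯, h =ᶠ[𝓝 (y : Y)] h' → Φ h = Φ h')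
    (Ψ : C^∞⟮𝓡 n, V; 𝓘(ℝ), ℝ⟯ →ₐ[ℝ] B) (hΨ : ∀ H, Ψ (restrictR V H) = Φ H) :
    Ψ = germHom Φ y hΦ := by
  ext h
  have hH := extension_eventuallyEq h y
  rw [germHom_apply]
  obtain ⟨χ, hχ, hχW⟩ := exists_bump (n := n) (inter_mem hH (V.2.mem_nhds y.2))
  have hmul : restrictR V χ * h = restrictR V χ * restrictR V (extension h y) := by
    ext z
    change χ z * h z = χ z * extension h y z
    by_cases hz : (z : Y) ∈ tsupport χ
    · have : extension h y z = Function.extend Subtype.val h 0 (z : Y) := (hχW hz).1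
      rw [this, extend_apply]
    · rw [image_eq_zero_of_notMem_tsupport hz, zero_mul, zero_mul]
  have h1 : Ψ (restrictR V χ) = 1 := by
    rw [hΨ, ← map_one Φ]
    exact hΦ _ _ hχ
  have h2 := congrArg Ψ hmul
  rwa [map_mul, map_mul, h1, one_mul, one_mul, hΨ] at h2

end GermHom

/-! ### The homomorphism induced over open sets -/

section Induced

variable {n : ℕ} {Y : Type*} [TopologicalSpace Y] [ChartedSpace (EuclideanSpace ℝ (Fin n)) Y]

/-- The value at a point of space-time of the homomorphism belonging to a smooth map from the small
towered superspace. -/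
noncomputable def SmallMap.sharpAt (F : SmallMap n Y) (x : Spacetime) :
    C^∞⟮𝓡 n, Y; 𝓘(ℝ), ℝ⟯ →ₐ[ℝ] smallRing ℂ :=
  (evalSmall x).comp F.sharp

theorem sharpAt_apply (F : SmallMap n Y) (x : Spacetime) (h : C^∞⟮𝓡 n, Y; 𝓘(ℝ), ℝ⟯) :
    F.sharpAt x h = evalSmall x (F.sharp h) :=
  AlgHom.comp_apply _ _ _

theorem component_zero_sharpAt (F : SmallMap n Y) (x : Spacetime) (h : C^∞⟮𝓡 n, Y; 𝓘(ℝ), ℝ⟯) :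
    component .zero (F.sharpAt x h) = (h (F.base x) : ℂ) := by
  rw [sharpAt_apply, component_evalSmall, F.component_zero_sharp]
  rfl

variable [T2Space Y] [IsManifold (𝓡 n) ∞ Y] (F : SmallMap n Y)

theorem sharpAt_eq_of_eventuallyEq (x : Spacetime) (h h' : C^∞⟮𝓡 n, Y; 𝓘(ℝ), ℝ⟯)
    (hh : h =ᶠ[𝓝 (F.base x)] h') : F.sharpAt x h = F.sharpAt x h' := by
  have h0 (h : C^∞⟮𝓡 n, Y; 𝓘(ℝ), ℝ⟯) (e : h (F.base x) = 0) :
      component .zero (F.sharpAt x h) = 0 := by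
    rw [component_zero_sharpAt, e, Complex.ofReal_zero]
  exact map_eq_of_eventuallyEq (F.sharpAt x) (F.base x) (fun h₁ h₂ h₃ h₄ h₅ e₁ e₂ e₃ e₄ e₅ =>
    mul₅_eq_zero (h0 h₁ e₁) (h0 h₂ e₂) (h0 h₃ e₃) (h0 h₄ e₄) (h0 h₅ e₅)) hh

variable {V : Opens Y} {U : Opens Spacetime} (hUV : Set.MapsTo F.base U V)

/-- The value at a point of `U` of the homomorphism on `C^∞(V)` that a smooth map from the small
towered superspace induces. -/
noncomputable def sharpGerm (x : U) : C^∞⟮𝓡 n, V; 𝓘(ℝ), ℝ⟯ →ₐ[ℝ] smallRing ℂ :=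
  germHom (F.sharpAt x) ⟨F.base x, hUV x.2⟩ (sharpAt_eq_of_eventuallyEq F x)

theorem component_zero_sharpGerm (x : U) (h : C^∞⟮𝓡 n, V; 𝓘(ℝ), ℝ⟯) :
    component .zero (sharpGerm F hUV x h) = (h ⟨F.base x, hUV x.2⟩ : ℂ) := by
  rw [sharpGerm, germHom_apply, component_zero_sharpAt]
  exact congrArg _ (extension_apply h ⟨F.base x, hUV x.2⟩)

/-- The components of the value at `h` of the induced homomorphism. -/
noncomputable def inducedComponent (h : C^∞⟮𝓡 n, V; 𝓘(ℝ), ℝ⟯) (k : SmallIndex) : smoothC U :=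
  ⟨fun x => component k (sharpGerm F hUV x h), fun x => by
    have h1 : ContMDiff 𝓘(ℝ, Spacetime) 𝓘(ℝ, ℂ) ∞ fun x' : U =>
        (component k (F.sharp (extension h ⟨F.base x, hUV x.2⟩))).1 x' :=
      (restrictC U (component k (F.sharp (extension h ⟨F.base x, hUV x.2⟩)))).2
    refine (h1 x).congr_of_eventuallyEq ?_
    -- The extension depends on the point. Near `x`, however, the one chosen at `x` still has the
    -- germ of `h` at the image of the nearby point, so the component coincides locally with that of
    -- a single global function.
    have hc : ContinuousAt (fun x' : U => F.base x') x :=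
      (F.base.contMDiff.continuous.comp continuous_subtype_val).continuousAt
    filter_upwards [hc.eventually
      (extension_eventuallyEq h ⟨F.base x, hUV x.2⟩).eventually_nhds] with x' hx'
    rw [← component_evalSmall, ← sharpAt_apply, sharpGerm, germHom_apply]
    exact congrArg _ (sharpAt_eq_of_eventuallyEq F x' _ _
      ((extension_eventuallyEq h ⟨F.base x', hUV x'.2⟩).trans (EventuallyEq.symm hx')))⟩

theorem inducedComponent_apply (h : C^∞⟮𝓡 n, V; 𝓘(ℝ), ℝ⟯) (k : SmallIndex) (x : U) :
    (inducedComponent F hUV h k).1 x = component k (sharpGerm F hUV x h) := rfl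

theorem evalSmall_induced (x : U) (h : C^∞⟮𝓡 n, V; 𝓘(ℝ), ℝ⟯) :
    evalSmall x (∑ k, inducedComponent F hUV h k • smallElt (smoothC U) k) =
      sharpGerm F hUV x h := by
  refine smallRing_ext fun k => ?_
  rw [component_evalSmall, component_sum_smul, inducedComponent_apply]

/-- The homomorphism that a smooth map from the small towered superspace induces over open sets. -/
noncomputable def inducedHom : C^∞⟮𝓡 n, V; 𝓘(ℝ), ℝ⟯ →ₐ[ℝ] smallRing (smoothC U) :=
  algHomOfPointwise evalSmall (fun _ _ => smallRing_ext_eval) (sharpGerm F hUV)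
    (fun h => ∑ k, inducedComponent F hUV h k • smallElt (smoothC U) k)
    (evalSmall_induced F hUV)

theorem evalSmall_inducedHom (x : U) (h : C^∞⟮𝓡 n, V; 𝓘(ℝ), ℝ⟯) :
    evalSmall x (inducedHom F hUV h) = sharpGerm F hUV x h :=
  evalSmall_induced F hUV x h

theorem inducedHom_isInducedOn : F.IsInducedOn V U (inducedHom F hUV) := fun h =>
  smallRing_ext_eval fun x =>
    (evalSmall_inducedHom F hUV x _).trans ((germHom_restrictR _ _ _ h).trans
      ((sharpAt_apply F x h).trans (evalSmall_restrictSmall U _ x).symm))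

theorem comp_eq_sharpGerm {g : C^∞⟮𝓡 n, V; 𝓘(ℝ), ℝ⟯ →ₐ[ℝ] smallRing (smoothC U)}
    (hg : F.IsInducedOn V U g) (x : U) : (evalSmall x).comp g = sharpGerm F hUV x :=
  eq_germHom _ _ _ _ fun H => by
    rw [AlgHom.comp_apply, hg, evalSmall_restrictSmall, sharpAt_apply]

theorem evalSmall_of_isInducedOn {g : C^∞⟮𝓡 n, V; 𝓘(ℝ), ℝ⟯ →ₐ[ℝ] smallRing (smoothC U)}
    (hg : F.IsInducedOn V U g) (x : U) (h : C^∞⟮𝓡 n, V; 𝓘(ℝ), ℝ⟯) :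
    evalSmall x (g h) = sharpGerm F hUV x h :=
  (AlgHom.comp_apply (evalSmall x) g h).symm.trans
    (DFunLike.congr_fun (comp_eq_sharpGerm F hUV hg x) h)

theorem eq_of_isInducedOn (hUV : Set.MapsTo F.base U V)
    {g g' : C^∞⟮𝓡 n, V; 𝓘(ℝ), ℝ⟯ →ₐ[ℝ] smallRing (smoothC U)}
    (hg : F.IsInducedOn V U g) (hg' : F.IsInducedOn V U g') : g = g' :=
  AlgHom.ext fun h => smallRing_ext_eval fun x => by
    rw [evalSmall_of_isInducedOn F hUV hg, evalSmall_of_isInducedOn F hUV hg']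

theorem component_zero_of_isInducedOn
    {g : C^∞⟮𝓡 n, V; 𝓘(ℝ), ℝ⟯ →ₐ[ℝ] smallRing (smoothC U)} (hg : F.IsInducedOn V U g)
    (h : C^∞⟮𝓡 n, V; 𝓘(ℝ), ℝ⟯) : component .zero (g h) = pullbackOn F.base hUV h := by
  refine Subtype.ext (funext fun x => ?_)
  rw [← component_evalSmall, evalSmall_of_isInducedOn F hUV hg, component_zero_sharpGerm]
  rfl

end Induced
end TowSup

namespace TowSup

open TopologicalSpace Filter Topology

/-! ### Transport of Taylor sums through evaluations and components -/

section TaylorSum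

variable {ι R A B : Type*} [Fintype ι] [CommRing R] [Ring A] [Algebra R A] [Module ℂ A] [Ring B]
  [Algebra ℂ B]

theorem map_taylorSum [Algebra ℝ A] [Algebra ℝ B] (ev : A →ₐ[ℝ] B) (e : R → ℂ) (hs : ∀ p s, ev (p • s) = e p • ev s)
    (hc : ∀ (c : ℂ) s, ev (c • s) = c • ev s)
    (ha : ∀ p, ev (algebraMap R A p) = algebraMap ℂ B (e p)) (p₀ : R) (p₁ : ι → R)
    (p₂ : ι → ι → R) (p₃ : ι → ι → ι → R) (p₄ : ι → ι → ι → ι → R) (ν : ι → A) :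
    ev (algebraMap R A p₀ + ∑ i, p₁ i • ν i + (1 / 2 : ℂ) • ∑ i, ∑ j, p₂ i j • (ν i * ν j)
      + (1 / 6 : ℂ) • ∑ i, ∑ j, ∑ k, p₃ i j k • (ν i * ν j * ν k)
      + (1 / 24 : ℂ) • ∑ i, ∑ j, ∑ k, ∑ l, p₄ i j k l • (ν i * ν j * ν k * ν l)) =
    algebraMap ℂ B (e p₀) + ∑ i, e (p₁ i) • ev (ν i)
      + (1 / 2 : ℂ) • ∑ i, ∑ j, e (p₂ i j) • (ev (ν i) * ev (ν j))
      + (1 / 6 : ℂ) • ∑ i, ∑ j, ∑ k, e (p₃ i j k) • (ev (ν i) * ev (ν j) * ev (ν k))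
      + (1 / 24 : ℂ) • ∑ i, ∑ j, ∑ k, ∑ l, e (p₄ i j k l) •
          (ev (ν i) * ev (ν j) * ev (ν k) * ev (ν l)) := by
  simp only [map_add, map_sum, map_mul, hs, hc, ha]

theorem map_taylorSum_linear [Algebra ℂ R] (κ : A →ₗ[R] R)
    (hc : ∀ (c : ℂ) s, κ (c • s) = c • κ s) (p₀ : R) (hp : κ (algebraMap R A p₀) = 0) (p₁ : ι → R)
    (p₂ : ι → ι → R) (p₃ : ι → ι → ι → R) (p₄ : ι → ι → ι → ι → R) (ν : ι → A) :
    κ (algebraMap R A p₀ + ∑ i, p₁ i • ν i + (1 / 2 : ℂ) • ∑ i, ∑ j, p₂ i j • (ν i * ν j)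
      + (1 / 6 : ℂ) • ∑ i, ∑ j, ∑ k, p₃ i j k • (ν i * ν j * ν k)
      + (1 / 24 : ℂ) • ∑ i, ∑ j, ∑ k, ∑ l, p₄ i j k l • (ν i * ν j * ν k * ν l)) =
    ∑ i, κ (ν i) * p₁ i
      + (1 / 2 : ℂ) • ∑ i, ∑ j, κ (ν i * ν j) * p₂ i j
      + (1 / 6 : ℂ) • ∑ i, ∑ j, ∑ k, κ (ν i * ν j * ν k) * p₃ i j k
      + (1 / 24 : ℂ) • ∑ i, ∑ j, ∑ k, ∑ l, κ (ν i * ν j * ν k * ν l) * p₄ i j k l := by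
  simp only [map_add, map_sum, hc, hp, zero_add, map_smul, smul_eq_mul, mul_comm (κ _)]

end TaylorSum

/-! ### The Taylor formula over open sets -/

section LocalDescription

variable {M : Type*} [TopologicalSpace M] [ChartedSpace Spacetime M]

theorem evalSmall_smul (x : M) (p : smoothC M) (s : smallRing (smoothC M)) :
    evalSmall x (p • s) = p.1 x • evalSmall x s :=
  smallMap_smul (evalC x) p s

theorem evalSmall_complex_smul (x : M) (c : ℂ) (s : smallRing (smoothC M)) :
    evalSmall x (c • s) = c • evalSmall x s :=
  smallMap_complex_smul (evalC x) c s

theorem evalSmall_algebraMap (x : M) (p : smoothC M) :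
    evalSmall x (algebraMap (smoothC M) (smallRing (smoothC M)) p) =
      algebraMap ℂ (smallRing ℂ) (p.1 x) :=
  smallMap_algebraMap (evalC x) p

theorem ofReal_smul_smallRing (r : ℝ) (s : smallRing ℂ) : (r : ℂ) • s = r • s :=
  algebraMap_smul ℂ r s

variable {n : ℕ} {Y : Type*} [TopologicalSpace Y] [T2Space Y]
  [ChartedSpace (EuclideanSpace ℝ (Fin n)) Y] [IsManifold (𝓡 n) ∞ Y] (F : SmallMap n Y)
  {φ : OpenPartialHomeomorph Y (EuclideanSpace ℝ (Fin n))}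
  (hφ : φ ∈ IsManifold.maximalAtlas (𝓡 n) ∞ Y) {U : Opens Spacetime}
  (hU : Set.MapsTo F.base U (chartDomain φ))
  {g : C^∞⟮𝓡 n, chartDomain φ; 𝓘(ℝ), ℝ⟯ →ₐ[ℝ] smallRing (smoothC U)}

/-- The chart formula at one point; the real values and derivatives of `h` are rewritten as complex
scalars. -/
theorem taylor_sharpGerm (x : U) (ν : Fin n → smallRing ℂ)
    (hν : ∀ i, ν i = sharpGerm F hU x (chartCoord hφ i) -
      algebraMap ℂ (smallRing ℂ) ((pullbackOn F.base hU (chartCoord hφ i)).1 x))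
    (h : C^∞⟮𝓡 n, chartDomain φ; 𝓘(ℝ), ℝ⟯) :
    sharpGerm F hU x h = algebraMap ℂ (smallRing ℂ) ((pullbackOn F.base hU h).1 x)
      + ∑ i, (pullbackOn F.base hU (chartPartials hφ [i] h)).1 x • ν i
      + (1 / 2 : ℂ) • ∑ i, ∑ j,
          (pullbackOn F.base hU (chartPartials hφ [i, j] h)).1 x • (ν i * ν j)
      + (1 / 6 : ℂ) • ∑ i, ∑ j, ∑ k,
          (pullbackOn F.base hU (chartPartials hφ [i, j, k] h)).1 x • (ν i * ν j * ν k)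
      + (1 / 24 : ℂ) • ∑ i, ∑ j, ∑ k, ∑ l,
          (pullbackOn F.base hU (chartPartials hφ [i, j, k, l] h)).1 x •
            (ν i * ν j * ν k * ν l) := by
  have h0 (h : C^∞⟮𝓡 n, chartDomain φ; 𝓘(ℝ), ℝ⟯) (e : h ⟨F.base x, hU x.2⟩ = 0) :
      component .zero (sharpGerm F hU x h) = 0 := by
    rw [component_zero_sharpGerm, e, Complex.ofReal_zero]
  have hp (h : C^∞⟮𝓡 n, chartDomain φ; 𝓘(ℝ), ℝ⟯) :
      (pullbackOn F.base hU h).1 x = ((h ⟨F.base x, hU x.2⟩ : ℝ) : ℂ) := rfl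
  have ha (r : ℝ) : algebraMap ℂ (smallRing ℂ) (r : ℂ) = algebraMap ℝ (smallRing ℂ) r := rfl
  simp only [hp, ha] at hν
  have hT := taylor_chart hφ ⟨F.base x, hU x.2⟩ (sharpGerm F hU x)
    (fun h₁ h₂ h₃ h₄ h₅ e₁ e₂ e₃ e₄ e₅ =>
      mul₅_eq_zero (h0 h₁ e₁) (h0 h₂ e₂) (h0 h₃ e₃) (h0 h₄ e₄) (h0 h₅ e₅)) ν hν h
  simp only [hp, ha, ofReal_smul_smallRing]
  rw [hT]
  simp only [← ofReal_smul_smallRing]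
  push_cast
  rfl

/-- Both sides agree after evaluation at each point of `U`, since evaluation carries `nil` to the
nilpotent parts at that point. -/
theorem taylor_of_isInducedOn (hg : F.IsInducedOn (chartDomain φ) U g)
    (nil : Fin n → smallRing (smoothC U))
    (hnil : ∀ i, nil i = g (chartCoord hφ i) -
      algebraMap (smoothC U) (smallRing (smoothC U)) (pullbackOn F.base hU (chartCoord hφ i)))
    (h : C^∞⟮𝓡 n, chartDomain φ; 𝓘(ℝ), ℝ⟯) :
    g h = algebraMap (smoothC U) (smallRing (smoothC U)) (pullbackOn F.base hU h)
        + ∑ i, pullbackOn F.base hU (chartPartials hφ [i] h) • nil i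
        + (1 / 2 : ℂ) • ∑ i, ∑ j,
            pullbackOn F.base hU (chartPartials hφ [i, j] h) • (nil i * nil j)
        + (1 / 6 : ℂ) • ∑ i, ∑ j, ∑ k,
            pullbackOn F.base hU (chartPartials hφ [i, j, k] h) • (nil i * nil j * nil k)
        + (1 / 24 : ℂ) • ∑ i, ∑ j, ∑ k, ∑ l,
            pullbackOn F.base hU (chartPartials hφ [i, j, k, l] h) •
              (nil i * nil j * nil k * nil l) := by
  refine smallRing_ext_eval fun x => (evalSmall_of_isInducedOn F hU hg x h).trans ?_
  have hν (i : Fin n) : evalSmall x (nil i) = sharpGerm F hU x (chartCoord hφ i) -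
      algebraMap ℂ (smallRing ℂ) ((pullbackOn F.base hU (chartCoord hφ i)).1 x) :=
    (congrArg (evalSmall x) (hnil i)).trans ((map_sub (evalSmall x) _ _).trans
      (congrArg₂ (· - ·) (evalSmall_of_isInducedOn F hU hg x _) (evalSmall_algebraMap x _)))
  exact (taylor_sharpGerm F hφ hU x (fun i => evalSmall x (nil i)) hν h).trans
    (map_taylorSum (R := smoothC U) (evalSmall x) (fun p => p.1 x) (evalSmall_smul x)
      (evalSmall_complex_smul x) (evalSmall_algebraMap x) (pullbackOn F.base hU h)
      (fun i => pullbackOn F.base hU (chartPartials hφ [i] h))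
      (fun i j => pullbackOn F.base hU (chartPartials hφ [i, j] h))
      (fun i j k => pullbackOn F.base hU (chartPartials hφ [i, j, k] h))
      (fun i j k l => pullbackOn F.base hU (chartPartials hφ [i, j, k, l] h)) nil).symm

end LocalDescription
end TowSup

namespace TowSup

open TopologicalSpace

theorem sum_mul_add_congr {R : Type*} [CommRing R] {n : ℕ} {a a' : Fin n → R}
    (h : ∀ i, a i = a' i) (P : Fin n → R) (x y z t : R) (ht : t = ∑ i, a i * P i + x + y + z) :
    t = ∑ i, a' i * P i + x + y + z := by
  rw [ht, funext h]

/-! ### The nilpotent parts of the coordinates and their products -/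

section NilpotentParts

variable {R : Type*} [CommRing R]

/-- The expansions never use the index `.zero`. Hence the components of the image of y^i may stand
for those of its nilpotent part; likewise for two and three factors. -/
theorem expansion₄_congr {A A' B B' C C' D D' : SmallIndex → R}
    (hA : ∀ k, k ≠ .zero → A k = A' k) (hB : ∀ k, k ≠ .zero → B k = B' k)
    (hC : ∀ k, k ≠ .zero → C k = C' k) (hD : ∀ k, k ≠ .zero → D k = D' k) :
    expansion₄ A B C D = expansion₄ A' B' C' D' := by
  simp only [expansion₄, symm₂, hA, hB, hC, hD, ne_eq, reduceCtorEq, not_false_eq_true]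

variable [Algebra ℂ R]

theorem component_complex_smul (k : SmallIndex) (c : ℂ) (s : smallRing R) :
    component k (c • s) = c • component k s := by
  rw [← algebraMap_smul R c s, map_smul, algebraMap_smul]

theorem expansion₂_congr {A A' B B' : SmallIndex → R} (hA : ∀ k, k ≠ .zero → A k = A' k)
    (hB : ∀ k, k ≠ .zero → B k = B' k) : expansion₂ A B = expansion₂ A' B' := by
  simp only [expansion₂, hA, hB, ne_eq, reduceCtorEq, not_false_eq_true]

theorem expansion₃_congr {A A' B B' C C' : SmallIndex → R} (hA : ∀ k, k ≠ .zero → A k = A' k)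
    (hB : ∀ k, k ≠ .zero → B k = B' k) (hC : ∀ k, k ≠ .zero → C k = C' k) :
    expansion₃ A B C = expansion₃ A' B' C' := by
  simp only [expansion₃, symm₃, symm₂, hA, hB, hC, ne_eq, reduceCtorEq, not_false_eq_true]

theorem coe_mul₂_eq_expansion₂ {x y : smallRing R} (hx : component .zero x = 0)
    (hy : component .zero y = 0) :
    ((x * y : smallRing R) : Grassmann R) =
      expansion₂ (fun k => component k x) (fun k => component k y) := by
  rw [coe_mul₂ hx hy, expansion₂_eq]; rfl

theorem coe_mul₃_eq_expansion₃ {x y z : smallRing R} (hx : component .zero x = 0)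
    (hy : component .zero y = 0) (hz : component .zero z = 0) :
    ((x * y * z : smallRing R) : Grassmann R) =
      expansion₃ (fun k => component k x) (fun k => component k y) (fun k => component k z) := by
  rw [coe_mul₃ hx hy hz, expansion₃_eq]; rfl

theorem coe_mul₄_eq_expansion₄ {x y z w : smallRing R} (hx : component .zero x = 0)
    (hy : component .zero y = 0) (hz : component .zero z = 0) (hw : component .zero w = 0) :
    ((x * y * z * w : smallRing R) : Grassmann R) =
      expansion₄ (fun k => component k x) (fun k => component k y) (fun k => component k z)
        (fun k => component k w) := by
  rw [coe_mul₄ hx hy hz hw, expansion₄_eq]; rfl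

theorem eq_sum_erase {x : smallRing R} (hx : component .zero x = 0) :
    x = ∑ k ∈ Finset.univ.erase .zero, component k x • smallElt R k := by
  conv_lhs => rw [sum_component x]
  rw [← Finset.add_sum_erase _ _ (Finset.mem_univ SmallIndex.zero), hx, zero_smul, zero_add]

theorem component_sub_algebraMap (s : smallRing R) (k : SmallIndex) (hk : k ≠ .zero) (r : R) :
    component k (s - algebraMap R (smallRing R) r) = component k s := by
  rw [map_sub, component_algebraMap, if_neg hk, sub_zero]

theorem component_zero_sub_algebraMap {s : smallRing R} {r : R} (h : component .zero s = r) :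
    component .zero (s - algebraMap R (smallRing R) r) = 0 := by
  rw [map_sub, component_algebraMap, if_pos rfl, h, sub_self]

theorem products_of_nilpotents {n : ℕ} {nil : Fin n → smallRing R} {c : Fin n → SmallIndex → R}
    (h0 : ∀ i, component .zero (nil i) = 0)
    (hc : ∀ i k, k ≠ .zero → c i k = component k (nil i)) :
    (∀ i, nil i = ∑ k ∈ Finset.univ.erase .zero, c i k • smallElt R k) ∧
      (∀ i j, ((nil i * nil j : smallRing R) : Grassmann R) = expansion₂ (c i) (c j)) ∧
      (∀ i j k, ((nil i * nil j * nil k : smallRing R) : Grassmann R) =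
        expansion₃ (c i) (c j) (c k)) ∧
      (∀ i j k l, ((nil i * nil j * nil k * nil l : smallRing R) : Grassmann R) =
        expansion₄ (c i) (c j) (c k) (c l)) ∧
      (∀ s i j, s.order < 2 → component s (nil i * nil j) = 0) ∧
      (∀ s i j k, s.order < 3 → component s (nil i * nil j * nil k) = 0) ∧
      (∀ s i j k l, s.order < 4 → component s (nil i * nil j * nil k * nil l) = 0) :=
  ⟨fun i => (eq_sum_erase (h0 i)).trans (Finset.sum_congr rfl fun k hk =>
      congrArg (· • smallElt R k) (hc i k (Finset.ne_of_mem_erase hk)).symm),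
    fun i j => (coe_mul₂_eq_expansion₂ (h0 i) (h0 j)).trans
      (expansion₂_congr (hc i) (hc j)).symm,
    fun i j k => (coe_mul₃_eq_expansion₃ (h0 i) (h0 j) (h0 k)).trans
      (expansion₃_congr (hc i) (hc j) (hc k)).symm,
    fun i j k l => (coe_mul₄_eq_expansion₄ (h0 i) (h0 j) (h0 k) (h0 l)).trans
      (expansion₄_congr (hc i) (hc j) (hc k) (hc l)).symm,
    fun _ i j hs => component_mul₂ (h0 i) (h0 j) hs,
    fun _ i j k hs => component_mul₃ (h0 i) (h0 j) (h0 k) hs,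
    fun _ i j k l hs => component_mul₄ (h0 i) (h0 j) (h0 k) (h0 l) hs⟩

theorem component_nil_eq {s nil : smallRing R} {r : R}
    (hnil : nil = s - algebraMap R (smallRing R) r) {c : R} {k : SmallIndex}
    (hc : c = component k s) (hk : k ≠ .zero) : c = component k nil := by
  rw [hnil, component_sub_algebraMap _ _ hk, hc]

end NilpotentParts

/-! ### Multi-index form of the operators -/

section Coefficients

variable {n : ℕ} {R : Type*} [CommRing R] [Algebra ℂ R]

theorem sum_fin_succ_arrow {M : Type*} [AddCommMonoid M] (m : ℕ) (f : (Fin (m + 1) → Fin n) → M) :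
    ∑ I, f I = ∑ i, ∑ J : Fin m → Fin n, f (Fin.cons i J) := by
  rw [← (Fin.consEquiv fun _ => Fin n).sum_comp, Fintype.sum_prod_type]
  rfl

/-- Coefficients indexed by multi-indices of length at most four, as one family. -/
noncomputable def multiCoeff (a₁ : Fin n → R) (a₂ : Fin n → Fin n → R)
    (a₃ : Fin n → Fin n → Fin n → R) (a₄ : Fin n → Fin n → Fin n → Fin n → R) :
    ∀ m : ℕ, (Fin m → Fin n) → R
  | 1, I => a₁ (I 0)
  | 2, I => (1 / 2 : ℂ) • a₂ (I 0) (I 1)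
  | 3, I => (1 / 6 : ℂ) • a₃ (I 0) (I 1) (I 2)
  | 4, I => (1 / 24 : ℂ) • a₄ (I 0) (I 1) (I 2) (I 3)
  -- Lengths 0 and above 4 do not occur in the sums of `sum_multiCoeff`.
  | _, _ => 0

/-- Converts the fourfold Taylor sum into the format of `IsDiffOpAlong`; the terms beyond order `r`
drop out by `e₂`, `e₃`, `e₄`. -/
theorem sum_multiCoeff (a₁ : Fin n → R) (a₂ : Fin n → Fin n → R)
    (a₃ : Fin n → Fin n → Fin n → R) (a₄ : Fin n → Fin n → Fin n → Fin n → R)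
    (r : ℕ) (h₁ : 1 ≤ r) (h₄ : r ≤ 4) (e₂ : r < 2 → ∀ i j, a₂ i j = 0)
    (e₃ : r < 3 → ∀ i j k, a₃ i j k = 0) (e₄ : r < 4 → ∀ i j k l, a₄ i j k l = 0)
    (P : List (Fin n) → R) :
    ∑ i, a₁ i * P [i] + (1 / 2 : ℂ) • ∑ i, ∑ j, a₂ i j * P [i, j]
      + (1 / 6 : ℂ) • ∑ i, ∑ j, ∑ k, a₃ i j k * P [i, j, k]
      + (1 / 24 : ℂ) • ∑ i, ∑ j, ∑ k, ∑ l, a₄ i j k l * P [i, j, k, l] =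
    ∑ m ∈ Finset.Icc 1 r, ∑ I : Fin m → Fin n,
      multiCoeff a₁ a₂ a₃ a₄ m I * P (List.ofFn I) := by
  have s₁ : ∑ I : Fin 1 → Fin n, multiCoeff a₁ a₂ a₃ a₄ 1 I * P (List.ofFn I) =
      ∑ i, a₁ i * P [i] := by
    simp [sum_fin_succ_arrow, multiCoeff]
  have s₂ : ∑ I : Fin 2 → Fin n, multiCoeff a₁ a₂ a₃ a₄ 2 I * P (List.ofFn I) =
      (1 / 2 : ℂ) • ∑ i, ∑ j, a₂ i j * P [i, j] := by
    simp only [sum_fin_succ_arrow, multiCoeff, Finset.smul_sum, smul_mul_assoc]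
    simp
  have s₃ : ∑ I : Fin 3 → Fin n, multiCoeff a₁ a₂ a₃ a₄ 3 I * P (List.ofFn I) =
      (1 / 6 : ℂ) • ∑ i, ∑ j, ∑ k, a₃ i j k * P [i, j, k] := by
    simp only [sum_fin_succ_arrow, multiCoeff, Finset.smul_sum, smul_mul_assoc]
    simp
    rfl
  have s₄ : ∑ I : Fin 4 → Fin n, multiCoeff a₁ a₂ a₃ a₄ 4 I * P (List.ofFn I) =
      (1 / 24 : ℂ) • ∑ i, ∑ j, ∑ k, ∑ l, a₄ i j k l * P [i, j, k, l] := by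
    simp only [sum_fin_succ_arrow, multiCoeff, Finset.smul_sum, smul_mul_assoc]
    simp
    rfl
  obtain rfl | rfl | rfl | rfl : r = 1 ∨ r = 2 ∨ r = 3 ∨ r = 4 := by omega
  · rw [show Finset.Icc 1 1 = {1} by decide, Finset.sum_singleton, s₁]
    simp [e₂, e₃, e₄]
  · rw [show Finset.Icc 1 2 = {1, 2} by decide, Finset.sum_insert (by decide),
      Finset.sum_singleton, s₁, s₂]
    simp [e₃, e₄]
  · rw [show Finset.Icc 1 3 = {1, 2, 3} by decide, Finset.sum_insert (by decide),
      Finset.sum_insert (by decide), Finset.sum_singleton, s₁, s₂, s₃]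
    simp [e₄, add_assoc]
  · rw [show Finset.Icc 1 4 = {1, 2, 3, 4} by decide, Finset.sum_insert (by decide),
      Finset.sum_insert (by decide), Finset.sum_insert (by decide), Finset.sum_singleton, s₁, s₂,
      s₃, s₄]
    simp only [add_assoc]

end Coefficients

/-! ### The components as differential operators along f -/

section DifferentialOperators

variable {n : ℕ} {Y : Type*} [TopologicalSpace Y] [T2Space Y]
  [ChartedSpace (EuclideanSpace ℝ (Fin n)) Y] [IsManifold (𝓡 n) ∞ Y] (F : SmallMap n Y)
  {φ : OpenPartialHomeomorph Y (EuclideanSpace ℝ (Fin n))}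
  (hφ : φ ∈ IsManifold.maximalAtlas (𝓡 n) ∞ Y) {U : Opens Spacetime}
  (hU : Set.MapsTo F.base U (chartDomain φ))
  {g : C^∞⟮𝓡 n, chartDomain φ; 𝓘(ℝ), ℝ⟯ →ₐ[ℝ] smallRing (smoothC U)}

theorem component_of_isInducedOn (hg : F.IsInducedOn (chartDomain φ) U g)
    (nil : Fin n → smallRing (smoothC U))
    (hnil : ∀ i, nil i = g (chartCoord hφ i) -
      algebraMap (smoothC U) (smallRing (smoothC U)) (pullbackOn F.base hU (chartCoord hφ i)))
    (s : SmallIndex) (hs : s ≠ .zero) (h : C^∞⟮𝓡 n, chartDomain φ; 𝓘(ℝ), ℝ⟯) :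
    component s (g h) =
        ∑ i, component s (nil i) * pullbackOn F.base hU (chartPartials hφ [i] h)
        + (1 / 2 : ℂ) • ∑ i, ∑ j, component s (nil i * nil j) *
            pullbackOn F.base hU (chartPartials hφ [i, j] h)
        + (1 / 6 : ℂ) • ∑ i, ∑ j, ∑ k, component s (nil i * nil j * nil k) *
            pullbackOn F.base hU (chartPartials hφ [i, j, k] h)
        + (1 / 24 : ℂ) • ∑ i, ∑ j, ∑ k, ∑ l, component s (nil i * nil j * nil k * nil l) *
            pullbackOn F.base hU (chartPartials hφ [i, j, k, l] h) :=
  (congrArg (component s) (taylor_of_isInducedOn F hφ hU hg nil hnil h)).trans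
    (map_taylorSum_linear (R := smoothC U) (component s) (component_complex_smul s)
      (pullbackOn F.base hU h) ((component_algebraMap _ s).trans (if_neg hs))
      (fun i => pullbackOn F.base hU (chartPartials hφ [i] h))
      (fun i j => pullbackOn F.base hU (chartPartials hφ [i, j] h))
      (fun i j k => pullbackOn F.base hU (chartPartials hφ [i, j, k] h))
      (fun i j k l => pullbackOn F.base hU (chartPartials hφ [i, j, k, l] h)) nil)

theorem component_zero_nil (hg : F.IsInducedOn (chartDomain φ) U g)
    {nil : Fin n → smallRing (smoothC U)}
    (hnil : ∀ i, nil i = g (chartCoord hφ i) -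
      algebraMap (smoothC U) (smallRing (smoothC U)) (pullbackOn F.base hU (chartCoord hφ i)))
    (i : Fin n) : component .zero (nil i) = 0 :=
  (congrArg (component .zero) (hnil i)).trans
    (component_zero_sub_algebraMap (component_zero_of_isInducedOn F hU hg _))

theorem SmallIndex.order_le (k : SmallIndex) : k.order ≤ 4 := by
  cases k <;> simp [SmallIndex.order]

theorem SmallIndex.one_le_order {k : SmallIndex} (hk : k ≠ .zero) : 1 ≤ k.order := by
  cases k <;> simp [SmallIndex.order] at hk ⊢

/-- Over `U`, the component comes from the induced homomorphism, whose Taylor formula supplies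
coefficients independent of `h`. The coefficients with more derivatives than `k.order` are
components of products and vanish by the degree count. -/
theorem isDiffOpAlong_component (k : SmallIndex) (hk : k ≠ .zero) :
    IsDiffOpAlong F.base k.order fun h => component k (F.sharp h) := by
  intro φ hφ U hU
  have hg := inducedHom_isInducedOn F hU
  let nil (i : Fin n) : smallRing (smoothC U) := inducedHom F hU (chartCoord hφ i) -
    algebraMap (smoothC U) (smallRing (smoothC U)) (pullbackOn F.base hU (chartCoord hφ i))
  have h0 (i : Fin n) : component .zero (nil i) = 0 :=
    component_zero_nil F hφ hU hg (fun _ => rfl) i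
  refine ⟨multiCoeff (fun i => component k (nil i)) (fun i j => component k (nil i * nil j))
    (fun i j l => component k (nil i * nil j * nil l))
    (fun i j l m => component k (nil i * nil j * nil l * nil m)), fun h => ?_⟩
  refine ((component_restrictSmall U (F.sharp h) k).symm.trans
    (congrArg (component k) (hg h).symm)).trans ?_
  refine (component_of_isInducedOn F hφ hU hg nil (fun _ => rfl) k hk _).trans ?_
  exact sum_multiCoeff _ _ _ _ k.order (SmallIndex.one_le_order hk) k.order_le
    (fun hr i j => component_mul₂ (h0 i) (h0 j) hr)
    (fun hr i j l => component_mul₃ (h0 i) (h0 j) (h0 l) hr)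
    (fun hr i j l m => component_mul₄ (h0 i) (h0 j) (h0 l) (h0 m) hr)
    (fun I => pullbackOn F.base hU (chartPartials hφ I (restrictR (chartDomain φ) h)))

end DifferentialOperators

end TowSup

open TowSup
theorem proposition5p1p3 (n : ℕ) (Y : Type*) [TopologicalSpace Y] [T2Space Y]
    [SecondCountableTopology Y] [ChartedSpace (EuclideanSpace ℝ (Fin n)) Y]
    [IsManifold (𝓡 n) ∞ Y] (F : SmallMap n Y) :
    -- presentation in components; the degree-zero component is `f^♯`
    (∀ h, F.sharp h = ∑ k, component k (F.sharp h) • smallElt (smoothC Spacetime) k) ∧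
    (∀ h, component .zero (F.sharp h) = pullback F.base h) ∧
    -- the other components are differential operators along `f` without zeroth-order term
    (∀ k, k ≠ .zero → IsDiffOpAlong F.base k.order (fun h => component k (F.sharp h))) ∧
    -- the homomorphism of sheaves of rings induced by `F`, and its degree-zero component
    (∀ (V : TopologicalSpace.Opens Y) (U : TopologicalSpace.Opens Spacetime)
        (hUV : Set.MapsTo F.base U V),
      ∃ g : C^∞⟮𝓡 n, V; 𝓘(ℝ), ℝ⟯ →ₐ[ℝ] smallRing (smoothC U),
        F.IsInducedOn V U g ∧ (∀ g', F.IsInducedOn V U g' → g' = g) ∧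
        ∀ h, component .zero (g h) = pullbackOn F.base hUV h) ∧
    -- the local description in a chart
    (∀ (φ : OpenPartialHomeomorph Y (EuclideanSpace ℝ (Fin n)))
        (hφ : φ ∈ IsManifold.maximalAtlas (𝓡 n) ∞ Y) (U : TopologicalSpace.Opens Spacetime)
        (hU : Set.MapsTo F.base U (chartDomain φ))
        (g : C^∞⟮𝓡 n, chartDomain φ; 𝓘(ℝ), ℝ⟯ →ₐ[ℝ] smallRing (smoothC U))
        (_ : F.IsInducedOn (chartDomain φ) U g)
        (c : Fin n → SmallIndex → smoothC U) (_ : ∀ i k, c i k = component k (g (chartCoord hφ i)))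
        (nil : Fin n → smallRing (smoothC U))
        (_ : ∀ i, nil i = g (chartCoord hφ i) -
          algebraMap (smoothC U) (smallRing (smoothC U)) (pullbackOn F.base hU (chartCoord hφ i))),
      -- the expansions of the nilpotent parts and of their products
      (∀ i, nil i = ∑ k ∈ Finset.univ.erase .zero, c i k • smallElt (smoothC U) k) ∧
      (∀ i j, ((nil i * nil j : smallRing (smoothC U)) : Grassmann (smoothC U)) =
        expansion₂ (c i) (c j)) ∧
      (∀ i j k, ((nil i * nil j * nil k : smallRing (smoothC U)) : Grassmann (smoothC U)) =
        expansion₃ (c i) (c j) (c k)) ∧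
      (∀ i j k l,
        ((nil i * nil j * nil k * nil l : smallRing (smoothC U)) : Grassmann (smoothC U)) =
        expansion₄ (c i) (c j) (c k) (c l)) ∧
      (∀ s i j, s.order < 2 → component s (nil i * nil j) = 0) ∧
      (∀ s i j k, s.order < 3 → component s (nil i * nil j * nil k) = 0) ∧
      (∀ s i j k l, s.order < 4 → component s (nil i * nil j * nil k * nil l) = 0) ∧
      -- the Taylor formula
      (∀ h, g h = algebraMap (smoothC U) (smallRing (smoothC U)) (pullbackOn F.base hU h)
        + ∑ i, pullbackOn F.base hU (chartPartials hφ [i] h) • nil i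
        + (1 / 2 : ℂ) • ∑ i, ∑ j,
            pullbackOn F.base hU (chartPartials hφ [i, j] h) • (nil i * nil j)
        + (1 / 6 : ℂ) • ∑ i, ∑ j, ∑ k,
            pullbackOn F.base hU (chartPartials hφ [i, j, k] h) • (nil i * nil j * nil k)
        + (1 / 24 : ℂ) • ∑ i, ∑ j, ∑ k, ∑ l,
            pullbackOn F.base hU (chartPartials hφ [i, j, k, l] h) •
              (nil i * nil j * nil k * nil l)) ∧
      -- the components as explicit differential operators
      (∀ s, s ≠ .zero → ∀ h, component s (g h) =
        ∑ i, c i s * pullbackOn F.base hU (chartPartials hφ [i] h)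
        + (1 / 2 : ℂ) • ∑ i, ∑ j, component s (nil i * nil j) *
            pullbackOn F.base hU (chartPartials hφ [i, j] h)
        + (1 / 6 : ℂ) • ∑ i, ∑ j, ∑ k, component s (nil i * nil j * nil k) *
            pullbackOn F.base hU (chartPartials hφ [i, j, k] h)
        + (1 / 24 : ℂ) • ∑ i, ∑ j, ∑ k, ∑ l, component s (nil i * nil j * nil k * nil l) *
            pullbackOn F.base hU (chartPartials hφ [i, j, k, l] h))) := by
  refine ⟨fun h => sum_component _, F.component_zero_sharp, isDiffOpAlong_component F,
    fun V U hUV => ⟨inducedHom F hUV, inducedHom_isInducedOn F hUV,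
      fun g' hg' => eq_of_isInducedOn F hUV hg' (inducedHom_isInducedOn F hUV),
      component_zero_of_isInducedOn F hUV (inducedHom_isInducedOn F hUV)⟩, ?_⟩
  intro φ hφ U hU g hg c hc nil hnil
  -- Subtracting the body of y^i changes only the component `.zero`.
  have hck (i : Fin n) (k : SmallIndex) (hk : k ≠ .zero) : c i k = component k (nil i) :=
    component_nil_eq (R := smoothC U) (hnil i) (hc i k) hk
  have h := products_of_nilpotents (R := smoothC U) (component_zero_nil F hφ hU hg hnil) hck
  exact ⟨h.1, h.2.1, h.2.2.1, h.2.2.2.1, h.2.2.2.2.1, h.2.2.2.2.2.1, h.2.2.2.2.2.2,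
    taylor_of_isInducedOn F hφ hU hg nil hnil, fun s hs h =>
    sum_mul_add_congr (R := smoothC U) (fun i => (hck i s hs).symm) _ _ _ _ _
      (component_of_isInducedOn F hφ hU hg nil hnil s hs h)⟩
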